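/- **Theorem 2.3.** For an even integer $n\ge 2$ let $G_n=(V,E)$ be the grid graph with vertex set $V=\{(i,j)\in\mathbb Z^2: 1\le i,j\le n\}$ and nearest-neighbour edges, and let $u=(1,n/2)$, $v=(n,n/2)$. Let $J=(J_e)_{e\in E}$ be i.i.d. standard Gaussian couplings and let $\sigma=\sigma(J)\in\{-1,+1\}^V$ be a ground state, i.e. a maximizer of $H(\sigma)=\sum_{e=\{x,y\}\in E}J_e\sigma_x\sigma_y$ (almost surely unique up to a global sign, so that $\sigma_u\sigma_v$ is almost surely a well-defined function of $J$). Let $h_k$, $k\ge 0$, be the Hermite polynomials normalized to be orthonormal with respect to the standard Gaussian law. For $\mathbf k=(k_e)_{e\in E}\in\{0,1,2,\dots\}^E$ put $h_{\mathbf k}(J)=\prod_{e\in E}h_{k_e}(J_e)$, $\alpha_{\mathbf k}=\mathbb E[\sigma_u\sigma_v\,h_{\mathbf k}(J)]$ and $E_{\mathbf k}=\{e\in E:k_e\ge 1\}$, and for $S\subseteq E$ define the spectral mass $$\mu(S)=\sum_{\mathbf k:\,E_{\mathbf k}=S}\alpha_{\mathbf k}^2 .$$ Then there exist $\varepsilon,c>0$,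 independent of $n$, such that for every even $n\ge 2$ $$\sum_{S\subseteq E,\ |S|\le(1+\varepsilon)n}\mu(S)\le \exp(-cn).$$ -/

import Mathlib

namespace EdwardsAnderson

open MeasureTheory ProbabilityTheory

noncomputable section

section Model

variable {V : Type*} [Fintype V] [DecidableEq V] (G : SimpleGraph V) [DecidableRel G.Adj]

/-- The energy `H(σ) = ∑_{e = {u,v}} J_e σ_u σ_v` of a spin configuration with values in
`ℤˣ = {1, -1}`, for the couplings `J`. -/
def hamiltonian (J : G.edgeSet → ℝ) (σ : V → ℤˣ) : ℝ :=
  ∑ e : G.edgeSet, J e * (((e.1.map σ).mul : ℤˣ) : ℤ)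

/-- Ground states are the maximizers of the energy (no minus sign in the convention). -/
def IsGroundState (J : G.edgeSet → ℝ) (σ : V → ℤˣ) : Prop :=
  ∀ τ : V → ℤˣ, hamiltonian G J τ ≤ hamiltonian G J σ

theorem exists_isGroundState (J : G.edgeSet → ℝ) :
    ∃ σ : V → ℤˣ, IsGroundState G J σ :=
  Finite.exists_max (hamiltonian G J)

/-- A ground state for the couplings `J`. For almost every `J` (with respect to the Gaussian
measure, `G` connected) it is unique up to a global sign. -/
def groundState (J : G.edgeSet → ℝ) : V → ℤˣ :=
  Classical.choose (exists_isGroundState G J)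

/-- The relative spin `σ_u σ_v` of the ground state, as a function of the couplings. -/
def relativeSpin (u v : V) (J : G.edgeSet → ℝ) : ℝ :=
  ((groundState G J u * groundState G J v : ℤˣ) : ℤ)

/-- The law of i.i.d. standard Gaussian couplings. -/
def couplingLaw : Measure (G.edgeSet → ℝ) :=
  Measure.pi fun _ => gaussianReal 0 1

/-- The Hermite polynomials `h_k`, orthonormal for the standard Gaussian
(`Polynomial.hermite` is the monic version, with squared norm `k!`). -/
def hermiteNormalized (k : ℕ) (x : ℝ) : ℝ :=
  Polynomial.aeval x (Polynomial.hermite k) / √(k.factorial : ℝ)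

/-- The tensor-product basis functions `h_k(J) = ∏_e h_{k_e}(J_e)`. -/
def hermiteTensor (k : G.edgeSet → ℕ) (J : G.edgeSet → ℝ) : ℝ :=
  ∏ e : G.edgeSet, hermiteNormalized (k e) (J e)

/-- The Fourier coefficient `α_k = E[σ_u σ_v h_k(J)]`. -/
def fourierCoeff (u v : V) (k : G.edgeSet → ℕ) : ℝ :=
  ∫ J, relativeSpin G u v J * hermiteTensor G k J ∂(couplingLaw G)

/-- The support `E_k = {e : k_e ≥ 1}` of a multi-index. -/
def edgeSupport (k : G.edgeSet → ℕ) : Finset G.edgeSet :=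
  {e | 1 ≤ k e}

/-- The spectral mass `μ(S) = ∑_{k : E_k = S} α_k²` of an edge set `S`. The sum is taken in
`[0, ∞]`, so that no summability convention intervenes. -/
def spectralMass (u v : V) (S : Finset G.edgeSet) : ENNReal :=
  ∑' k : {k : G.edgeSet → ℕ // edgeSupport G k = S}, ENNReal.ofReal (fourierCoeff G u v k.1 ^ 2)

end Model

/-- The vertices `(i, j) ∈ ℤ²` with `1 ≤ i, j ≤ n`. -/
abbrev GridVertex (n : ℕ) : Type :=
  {p : ℤ × ℤ // p ∈ Finset.Icc (1 : ℤ) n ×ˢ Finset.Icc (1 : ℤ) n}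

/-- The `n × n` grid with nearest neighbor edges. -/
def grid (n : ℕ) : SimpleGraph (GridVertex n) where
  Adj p q := |p.1.1 - q.1.1| + |p.1.2 - q.1.2| = 1
  symm := ⟨fun p q h => by rw [abs_sub_comm q.1.1, abs_sub_comm q.1.2]; exact h⟩
  loopless := ⟨fun p h => by simp at h⟩

instance (n : ℕ) : DecidableRel (grid n).Adj :=
  fun p q => inferInstanceAs (Decidable (|p.1.1 - q.1.1| + |p.1.2 - q.1.2| = 1))

/-- The vertex `(1, n/2)`. -/
def leftVertex (n : ℕ) (hn : 2 ≤ n) : GridVertex n :=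
  ⟨(1, (n : ℤ) / 2), by simp only [Finset.mem_product, Finset.mem_Icc]; omega⟩

/-- The vertex `(n, n/2)`. -/
def rightVertex (n : ℕ) (hn : 2 ≤ n) : GridVertex n :=
  ⟨((n : ℤ), (n : ℤ) / 2), by simp only [Finset.mem_product, Finset.mem_Icc]; omega⟩

end

end EdwardsAnderson

/-!
Flipping the signs of all couplings on an edge boundary is a gauge transformation: it preserves
the Gaussian law and multiplies `σ_u σ_v` by `-1` exactly when the boundary separates `u` from `v`.
Hence `α_k ≠ 0` forces `u` and `v` to be joined by a path of edges `e` with `k_e` odd. Such a path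
crosses each column, and if it has at most `(1 + ε) n` edges, then the heights of the crossings
have variation at most `2 ε n`. The number of such sequences of heights is at most `exp (δ n)`,
where `δ` tends to `0` with `ε`.

Fix such a sequence and choose, in every third column, a unit square at the crossing. The
neighborhoods of these squares are disjoint, and with probability bounded below the couplings of
a neighborhood shield the crossing edge: `σ_u σ_v` does not depend on the sign of its coupling.
Coefficients with `k_e` odd at all chosen edges only see the event that no square is shielded,
so by Bessel's inequality their squares have a sum that is exponentially small in `n`, at a rate
that does not depend on `ε`.
-/

namespace EdwardsAnderson

open MeasureTheory ProbabilityTheory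

/-! ### Hermite polynomials -/

section Hermite

open Polynomial

theorem integrable_eval_gaussianReal (μ : ℝ) (v : NNReal) (p : ℝ[X]) :
    Integrable (fun x => p.eval x) (gaussianReal μ v) := by
  induction p using Polynomial.induction_on' with
  | add p q hp hq =>
    simp only [eval_add]
    exact hp.add hq
  | monomial n a =>
    simp only [eval_monomial]
    refine Integrable.const_mul ((integrable_norm_iff (by fun_prop)).1 ?_) a
    simpa using (memLp_id_gaussianReal (μ := μ) (v := v) n).integrable_norm_pow'

theorem hasDerivAt_gaussianPDFReal (μ : ℝ) (v : NNReal) (x : ℝ) :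
    HasDerivAt (gaussianPDFReal μ v) (-((x - μ) / v) * gaussianPDFReal μ v x) x := by
  have hexponent : HasDerivAt (fun x : ℝ => -(x - μ) ^ 2 / (2 * (v : ℝ))) (-((x - μ) / v)) x := by
    refine ((((hasDerivAt_id x).sub_const μ).pow 2).neg.div_const (2 * (v : ℝ))).congr_deriv ?_
    simp only [id_eq, Nat.cast_ofNat, Nat.add_one_sub_one, pow_one, mul_one, neg_div]
    rw [mul_div_mul_left _ _ two_ne_zero]
  rw [gaussianPDFReal_def]
  refine (hexponent.exp.const_mul (√(2 * Real.pi * (v : ℝ)))⁻¹).congr_deriv ?_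
  ring

theorem integrable_eval_mul_gaussianPDFReal (μ : ℝ) {v : NNReal} (hv : v ≠ 0) (p : ℝ[X]) :
    Integrable (fun x => p.eval x * gaussianPDFReal μ v x) := by
  have h := integrable_eval_gaussianReal μ v p
  rw [gaussianReal_of_var_ne_zero _ hv, integrable_withDensity_iff (measurable_gaussianPDF μ v)
    (ae_of_all _ fun _ => gaussianPDF_lt_top)] at h
  simpa [toReal_gaussianPDF] using h

theorem integral_sub_mul_eval_gaussianReal (μ : ℝ) {v : NNReal} (hv : v ≠ 0) (p : ℝ[X]) :
    ∫ x, (x - μ) * p.eval x ∂(gaussianReal μ v) =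
      v * ∫ x, (derivative p).eval x ∂(gaussianReal μ v) := by
  have hv' : (v : ℝ) ≠ 0 := by exact_mod_cast hv
  have hparts := integral_mul_deriv_eq_deriv_mul_of_integrable
    (fun x _ => p.hasDerivAt x) (fun x _ => hasDerivAt_gaussianPDFReal μ v x)
    ((integrable_eval_mul_gaussianPDFReal μ hv (-(C (v : ℝ)⁻¹ * (X - C μ) * p))).congr
      (ae_of_all _ fun x => by
        simp only [eval_neg, eval_mul, eval_C, eval_sub, eval_X, Pi.mul_apply]; ring))
    (integrable_eval_mul_gaussianPDFReal μ hv _) (integrable_eval_mul_gaussianPDFReal μ hv _)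
  simp only [integral_gaussianReal_eq_integral_smul hv, smul_eq_mul]
  calc ∫ x, gaussianPDFReal μ v x * ((x - μ) * p.eval x)
      = -(v * ∫ x, p.eval x * (-((x - μ) / v) * gaussianPDFReal μ v x)) := by
        rw [← integral_const_mul, ← integral_neg]
        exact integral_congr_ae (ae_of_all _ fun x => by field_simp)
    _ = v * ∫ x, gaussianPDFReal μ v x * (derivative p).eval x := by
        simp only [hparts, mul_neg, neg_neg, mul_comm (gaussianPDFReal μ v _)]

/-- The monic Hermite polynomial `Polynomial.hermite n`, over `ℝ`. -/
noncomputable def realHermite (n : ℕ) : ℝ[X] := (hermite n).map (algebraMap ℤ ℝ)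

@[simp]
theorem realHermite_zero : realHermite 0 = 1 := by simp [realHermite]

theorem realHermite_succ (n : ℕ) :
    realHermite (n + 1) = X * realHermite n - derivative (realHermite n) := by
  simp [realHermite, hermite_succ, derivative_map]

theorem natDegree_realHermite (n : ℕ) : (realHermite n).natDegree = n := by
  rw [realHermite, (hermite_monic n).natDegree_map, natDegree_hermite]

theorem integral_realHermite_mul (n : ℕ) (q : ℝ[X]) :
    ∫ x, (realHermite n * q).eval x ∂(gaussianReal 0 1) =
      ∫ x, (derivative^[n] q).eval x ∂(gaussianReal 0 1) := by
  induction n generalizing q with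
  | zero => simp
  | succ n ih =>
    have hint := integrable_eval_gaussianReal 0 1
    have hparts := integral_sub_mul_eval_gaussianReal 0 one_ne_zero (realHermite n * q)
    simp only [sub_zero, NNReal.coe_one, one_mul, derivative_mul, eval_add] at hparts
    rw [integral_add (hint _) (hint _)] at hparts
    calc ∫ x, (realHermite (n + 1) * q).eval x ∂(gaussianReal 0 1)
        = ∫ x, x * (realHermite n * q).eval x ∂(gaussianReal 0 1) -
            ∫ x, (derivative (realHermite n) * q).eval x ∂(gaussianReal 0 1) := by
          rw [realHermite_succ, sub_mul, mul_assoc]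
          simp only [eval_sub]
          rw [integral_sub (hint _) (hint _)]
          simp only [eval_mul, eval_X]
      _ = ∫ x, (realHermite n * derivative q).eval x ∂(gaussianReal 0 1) := by
          rw [hparts, add_sub_cancel_left]
      _ = ∫ x, (derivative^[n + 1] q).eval x ∂(gaussianReal 0 1) := by
          rw [ih, Function.iterate_succ_apply]

theorem iterate_derivative_realHermite_self (n : ℕ) :
    derivative^[n] (realHermite n) = C (n.factorial : ℝ) := by
  have hconst : (derivative^[n] (realHermite n)).natDegree = 0 := by
    have := natDegree_iterate_derivative (realHermite n) n
    rw [natDegree_realHermite] at this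
    omega
  rw [eq_C_of_natDegree_eq_zero hconst, coeff_iterate_derivative]
  simp [realHermite, Nat.descFactorial_self]

theorem integral_realHermite_mul_realHermite (m n : ℕ) :
    ∫ x, (realHermite m * realHermite n).eval x ∂(gaussianReal 0 1) =
      if m = n then (n.factorial : ℝ) else 0 := by
  wlog hmn : n ≤ m generalizing m n
  · rw [mul_comm, this n m (le_of_not_ge hmn)]
    exact if_ctx_congr eq_comm (fun h => by rw [h]) fun _ => rfl
  rw [integral_realHermite_mul]
  split_ifs with h
  · rw [h, iterate_derivative_realHermite_self]
    simp
  · rw [iterate_derivative_eq_zero (by rw [natDegree_realHermite]; omega)]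
    simp

theorem realHermite_comp_neg_X (n : ℕ) :
    (realHermite n).comp (-X) = (-1) ^ n * realHermite n := by
  induction n with
  | zero => simp
  | succ n ih =>
    have hderiv := congrArg derivative ih
    have hconst : derivative ((-1 : ℝ[X]) ^ n) = 0 := by
      rw [show ((-1 : ℝ[X]) ^ n) = C ((-1) ^ n) by simp, derivative_C]
    rw [derivative_comp, derivative_mul, hconst, derivative_neg, derivative_X] at hderiv
    rw [realHermite_succ, sub_comp, mul_comp, ih, X_comp]
    linear_combination hderiv

theorem hermiteNormalized_eq (n : ℕ) (x : ℝ) :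
    hermiteNormalized n x = (realHermite n).eval x / √(n.factorial : ℝ) := by
  rw [hermiteNormalized, realHermite, eval_map_algebraMap]

theorem continuous_hermiteNormalized (n : ℕ) : Continuous (hermiteNormalized n) := by
  simp only [funext (hermiteNormalized_eq n)]
  fun_prop

theorem hermiteNormalized_neg (n : ℕ) (x : ℝ) :
    hermiteNormalized n (-x) = (-1) ^ n * hermiteNormalized n x := by
  have h := congrArg (eval x) (realHermite_comp_neg_X n)
  simp only [eval_comp, eval_neg, eval_X, eval_mul, eval_pow, eval_one] at h
  rw [hermiteNormalized_eq, hermiteNormalized_eq, h, mul_div_assoc]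

theorem hermiteNormalized_mul (m n : ℕ) (x : ℝ) :
    hermiteNormalized m x * hermiteNormalized n x =
      (realHermite m * realHermite n).eval x / (√(m.factorial : ℝ) * √(n.factorial : ℝ)) := by
  rw [hermiteNormalized_eq, hermiteNormalized_eq, eval_mul, div_mul_div_comm]

theorem integrable_hermiteNormalized_mul (m n : ℕ) :
    Integrable (fun x => hermiteNormalized m x * hermiteNormalized n x) (gaussianReal 0 1) := by
  simp only [hermiteNormalized_mul]
  exact (integrable_eval_gaussianReal 0 1 _).div_const _

theorem integral_hermiteNormalized_mul (m n : ℕ) :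
    ∫ x, hermiteNormalized m x * hermiteNormalized n x ∂(gaussianReal 0 1) =
      if m = n then 1 else 0 := by
  simp only [hermiteNormalized_mul]
  rw [integral_div, integral_realHermite_mul_realHermite]
  split_ifs with h
  · rw [h, Real.mul_self_sqrt (by positivity), div_self (by positivity)]
  · exact zero_div _

end Hermite

/-! ### Product measures -/

section Pi

variable {ι : Type*} [Fintype ι] {X : ι → Type*} [∀ i, MeasurableSpace (X i)]
  (μ : ∀ i, Measure (X i))

theorem measure_pi_eq_zero_of_forall_update [DecidableEq ι] [∀ i, SigmaFinite (μ i)]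
    {s : Set (∀ i, X i)} (hs : MeasurableSet s) (i : ι)
    (h : ∀ x, μ i {t | Function.update x i t ∈ s} = 0) : Measure.pi μ s = 0 := by
  have hsection : ∫⋯∫⁻_{i}, s.indicator 1 ∂μ = ∫⋯∫⁻_{i}, 0 ∂μ := by
    rw [lmarginal_singleton, lmarginal_singleton]
    funext x
    simp only [Pi.zero_apply, lintegral_zero]
    calc ∫⁻ t, s.indicator 1 (Function.update x i t) ∂μ i
        = μ i {t | Function.update x i t ∈ s} :=
          lintegral_indicator_one (hs.preimage (measurable_update x))
      _ = 0 := h x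
  rw [← lintegral_indicator_one hs, lintegral_eq_of_lmarginal_eq {i}
    (measurable_one.indicator hs) measurable_zero hsection]
  exact lintegral_zero

theorem measure_pi_hyperplane_eq_zero (ν : ι → Measure ℝ) [∀ i, SigmaFinite (ν i)]
    [∀ i, NullSingletonClass (ν i)] {c : ι → ℝ} (hc : c ≠ 0) :
    Measure.pi ν {x | ∑ i, c i * x i = 0} = 0 := by
  classical
  obtain ⟨i, hi⟩ := Function.ne_iff.1 hc
  refine measure_pi_eq_zero_of_forall_update ν
    (measurableSet_eq_fun (by fun_prop) measurable_const) i fun x => ?_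
  refine Set.Subsingleton.measure_zero (fun t ht t' ht' => ?_) _
  have hsum : ∀ t, ∑ j, c j * Function.update x i t j =
      c i * t + ∑ j ∈ Finset.univ.erase i, c j * x j := fun t => by
    rw [← Finset.add_sum_erase _ _ (Finset.mem_univ i), Function.update_self]
    congr 1
    exact Finset.sum_congr rfl fun j hj => by rw [Function.update_of_ne (Finset.ne_of_mem_erase hj)]
  simp only [Set.mem_ofPred_eq, hsum] at ht ht'
  exact mul_left_cancel₀ hi (by linarith)

variable [∀ i, IsProbabilityMeasure (μ i)]

theorem iIndepSet_pi_of_pairwiseDisjoint {κ : Type*} {B : κ → Finset ι}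
    {A : κ → ∀ i, Set (X i)} (hA : ∀ j i, MeasurableSet (A j i))
    (hB : Pairwise (Function.onFun Disjoint B)) :
    iIndepSet (fun j => (B j : Set ι).pi (A j)) (Measure.pi μ) := by
  classical
  rw [iIndepSet_iff_meas_biInter fun j =>
    MeasurableSet.pi (Set.to_countable _) fun i _ => hA j i]
  intro t
  have hbox : ⋂ j ∈ t, (B j : Set ι).pi (A j) =
      (t.biUnion B : Set ι).pi fun i => ⋂ j ∈ t, ⋂ (_ : i ∈ B j), A j i := by
    ext x
    simp only [Set.mem_iInter, Set.mem_pi, Finset.mem_coe, Finset.mem_biUnion]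
    exact ⟨fun h i _ j hj hi => h j hj i hi, fun h j hj i hi => h i ⟨j, hj, hi⟩ j hj hi⟩
  rw [hbox, Measure.pi_pi_finset, Finset.prod_biUnion (hB.set_pairwise _)]
  refine Finset.prod_congr rfl fun j hj => ?_
  rw [Measure.pi_pi_finset]
  refine Finset.prod_congr rfl fun i hi => congrArg _ ?_
  refine Set.Subset.antisymm (Set.biInter_subset_of_mem hj |>.trans (Set.iInter_subset _ hi)) ?_
  refine Set.subset_iInter₂ fun l _ => Set.subset_iInter fun hil => ?_
  obtain rfl : l = j := by
    by_contra hne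
    exact Finset.disjoint_left.1 (hB hne) hil hi
  exact subset_rfl

theorem measure_iInter_compl_pi_le {κ : Type*} [Fintype κ] {B : κ → Finset ι}
    {A : κ → ∀ i, Set (X i)} (hA : ∀ j i, MeasurableSet (A j i))
    (hB : Pairwise (Function.onFun Disjoint B)) {q : ENNReal}
    (hq : ∀ j, Measure.pi μ ((B j : Set ι).pi (A j))ᶜ ≤ q) :
    Measure.pi μ (⋂ j, ((B j : Set ι).pi (A j))ᶜ) ≤ q ^ Fintype.card κ := by
  rw [((iIndepSet_iff_iIndep _ _).1 (iIndepSet_pi_of_pairwiseDisjoint μ hA hB)).meas_iInter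
    fun j => (MeasurableSpace.measurableSet_generateFrom (Set.mem_singleton _)).compl]
  exact Finset.prod_le_pow_card _ _ _ fun j _ => hq j

theorem pow_card_le_measure_pi (B : Finset ι) {A : ∀ i, Set (X i)} {p : ENNReal}
    (hp : ∀ i ∈ B, p ≤ μ i (A i)) : p ^ B.card ≤ Measure.pi μ ((B : Set ι).pi A) := by
  rw [Measure.pi_pi_finset]
  exact Finset.pow_card_le_prod _ _ _ hp

end Pi

/-! ### Gaussian product measures and sign flips -/

section Gaussian

theorem abs_intUnit_cast (s : ℤˣ) : |((s : ℤ) : ℝ)| = 1 := by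
  rcases Int.units_eq_one_or s with rfl | rfl <;> simp

theorem intUnit_cast_mul_self (s : ℤˣ) : ((s : ℤ) : ℝ) * ((s : ℤ) : ℝ) = 1 := by
  rcases Int.units_eq_one_or s with rfl | rfl <;> simp

theorem intUnit_smul_eq_mul (s : ℤˣ) (x : ℝ) : s • x = ((s : ℤ) : ℝ) * x := by
  rw [Units.smul_def, zsmul_eq_mul]

theorem abs_intUnit_smul (s : ℤˣ) (x : ℝ) : |s • x| = |x| := by
  rw [intUnit_smul_eq_mul, abs_mul, abs_intUnit_cast, one_mul]

variable {ι : Type*} [Fintype ι]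

/-- The law of a family of independent standard Gaussian variables indexed by `ι`. -/
noncomputable abbrev stdGaussianPi (ι : Type*) [Fintype ι] : Measure (ι → ℝ) :=
  Measure.pi fun _ => gaussianReal 0 1

theorem stdGaussianPi_hyperplane_eq_zero {c : ι → ℝ} (hc : c ≠ 0) :
    stdGaussianPi ι {J | ∑ i, c i * J i = 0} = 0 :=
  have : NullSingletonClass (gaussianReal 0 1) := nullSingletonClass_gaussianReal one_ne_zero
  measure_pi_hyperplane_eq_zero _ hc

theorem measurePreserving_intUnit_smul (s : ι → ℤˣ) :
    MeasurePreserving (fun J : ι → ℝ => s • J) (stdGaussianPi ι) (stdGaussianPi ι) := by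
  refine measurePreserving_pi _ _ (f := fun i x => s i • x) fun i => ⟨by fun_prop, ?_⟩
  simp only [intUnit_smul_eq_mul, gaussianReal_map_const_mul]
  rcases Int.units_eq_one_or (s i) with h | h <;> simp [h]

theorem integral_comp_intUnit_smul (s : ι → ℤˣ) (f : (ι → ℝ) → ℝ) :
    ∫ J, f (s • J) ∂(stdGaussianPi ι) = ∫ J, f J ∂(stdGaussianPi ι) :=
  have hinvolutive : Function.Involutive fun J : ι → ℝ => s • J := fun J => by
    funext i
    change s i • s i • J i = J i
    rw [smul_smul, Int.units_mul_self, one_smul]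
  (measurePreserving_intUnit_smul s).integral_comp
    (MeasurableEquiv.ofInvolutive _ hinvolutive
      (measurePreserving_intUnit_smul s).measurable).measurableEmbedding f

/-- The product `∏ᵢ h_{kᵢ}(Jᵢ)` of normalized Hermite polynomials, over an arbitrary finite index
type; `hermiteTensor` is the case of the edges of a graph. -/
noncomputable def hermitePi (k : ι → ℕ) (J : ι → ℝ) : ℝ := ∏ i, hermiteNormalized (k i) (J i)

theorem continuous_hermitePi (k : ι → ℕ) : Continuous (hermitePi k) :=
  continuous_finsetProd _ fun i _ => (continuous_hermiteNormalized (k i)).comp (continuous_apply i)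

theorem hermitePi_mul (k l : ι → ℕ) (J : ι → ℝ) :
    hermitePi k J * hermitePi l J =
      ∏ i, hermiteNormalized (k i) (J i) * hermiteNormalized (l i) (J i) :=
  Finset.prod_mul_distrib.symm

theorem integral_hermitePi_mul (k l : ι → ℕ) [Decidable (k = l)] :
    ∫ J, hermitePi k J * hermitePi l J ∂(stdGaussianPi ι) = if k = l then 1 else 0 := by
  simp only [hermitePi_mul]
  rw [integral_fintype_prod_eq_prod
    (f := fun i x => hermiteNormalized (k i) x * hermiteNormalized (l i) x)]
  simp only [integral_hermiteNormalized_mul]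
  split_ifs with h
  · exact Finset.prod_eq_one fun i _ => if_pos (congrFun h i)
  · obtain ⟨i, hi⟩ := Function.ne_iff.1 h
    exact Finset.prod_eq_zero (Finset.mem_univ i) (if_neg hi)

theorem memLp_hermitePi (k : ι → ℕ) : MemLp (hermitePi k) 2 (stdGaussianPi ι) := by
  rw [memLp_two_iff_integrable_sq (continuous_hermitePi k).aestronglyMeasurable]
  simp only [sq, hermitePi_mul]
  exact Integrable.fintype_prod (μ := fun _ : ι => gaussianReal 0 1)
    fun i => integrable_hermiteNormalized_mul (k i) (k i)

theorem hermitePi_intUnit_smul (k : ι → ℕ) (s : ι → ℤˣ) (J : ι → ℝ) :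
    hermitePi k (s • J) = (((∏ i, s i ^ k i : ℤˣ) : ℤ) : ℝ) * hermitePi k J := by
  simp only [hermitePi, Units.coe_prod, Int.cast_prod, ← Finset.prod_mul_distrib]
  refine Finset.prod_congr rfl fun i _ => ?_
  rcases Int.units_eq_one_or (s i) with h | h <;> simp [h, hermiteNormalized_neg]

theorem integral_mul_hermitePi_eq_zero {g : (ι → ℝ) → ℝ} {s : ι → ℤˣ} {ε : ℤˣ} {k : ι → ℕ}
    (hg : ∀ᵐ J ∂(stdGaussianPi ι), g (s • J) = ((ε : ℤ) : ℝ) * g J)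
    (hodd : ε * ∏ i, s i ^ k i = -1) :
    ∫ J, g J * hermitePi k J ∂(stdGaussianPi ι) = 0 := by
  rw [← self_eq_neg, ← integral_neg]
  calc ∫ J, g J * hermitePi k J ∂(stdGaussianPi ι)
      = ∫ J, g (s • J) * hermitePi k (s • J) ∂(stdGaussianPi ι) :=
        (integral_comp_intUnit_smul s fun J => g J * hermitePi k J).symm
    _ = ∫ J, -(g J * hermitePi k J) ∂(stdGaussianPi ι) := integral_congr_ae <| by
        filter_upwards [hg] with J hJ
        have hsign : ((ε : ℤ) : ℝ) * (((∏ i, s i ^ k i : ℤˣ) : ℤ) : ℝ) = -1 := by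
          rw [← Int.cast_mul, ← Units.val_mul, hodd]
          simp
        rw [hJ, hermitePi_intUnit_smul, mul_mul_mul_comm, hsign, neg_one_mul]

theorem sum_sq_integral_mul_hermitePi_le {g : (ι → ℝ) → ℝ} (hg : MemLp g 2 (stdGaussianPi ι))
    (s : Finset (ι → ℕ)) :
    ∑ k ∈ s, (∫ J, g J * hermitePi k J ∂(stdGaussianPi ι)) ^ 2 ≤
      ∫ J, g J ^ 2 ∂(stdGaussianPi ι) := by
  classical
  have hinner : ∀ {a b : (ι → ℝ) → ℝ} (ha : MemLp a 2 (stdGaussianPi ι))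
      (hb : MemLp b 2 (stdGaussianPi ι)),
      inner ℝ (ha.toLp a) (hb.toLp b) = ∫ J, b J * a J ∂(stdGaussianPi ι) := by
    intro a b ha hb
    rw [L2.inner_def]
    refine integral_congr_ae ?_
    filter_upwards [ha.coeFn_toLp, hb.coeFn_toLp] with J h₁ h₂
    simp [h₁, h₂]
  have horth : Orthonormal ℝ fun k : ι → ℕ => (memLp_hermitePi k).toLp (hermitePi k) := by
    rw [orthonormal_iff_ite]
    intro k l
    rw [hinner, integral_hermitePi_mul]
    simp only [eq_comm]
  have hbessel := horth.sum_inner_products_le (s := s) (hg.toLp g)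
  rw [← real_inner_self_eq_norm_sq, hinner] at hbessel
  simpa only [hinner, Real.norm_eq_abs, sq_abs, ← sq] using hbessel

theorem tsum_sq_integral_mul_hermitePi_le {g : (ι → ℝ) → ℝ} (hg : MemLp g 2 (stdGaussianPi ι))
    (K : Set (ι → ℕ)) :
    ∑' k : K, ENNReal.ofReal ((∫ J, g J * hermitePi k.1 J ∂(stdGaussianPi ι)) ^ 2) ≤
      ENNReal.ofReal (∫ J, g J ^ 2 ∂(stdGaussianPi ι)) := by
  rw [ENNReal.tsum_eq_iSup_sum]
  refine iSup_le fun s => ?_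
  rw [← ENNReal.ofReal_sum_of_nonneg fun _ _ => sq_nonneg _]
  refine ENNReal.ofReal_le_ofReal ?_
  simpa only [Finset.sum_map, Function.Embedding.coe_subtype] using
    sum_sq_integral_mul_hermitePi_le hg (s.map (Function.Embedding.subtype _))

end Gaussian

/-! ### Ground states -/

section GroundStates

variable {V : Type*} (G : SimpleGraph V)

/-- The product `σ_x σ_y` of the spins at the endpoints of an edge. -/
def edgeSpin (σ : V → ℤˣ) (e : G.edgeSet) : ℤˣ := (e.1.map σ).mul

theorem edgeSpin_mk (σ : V → ℤˣ) {x y : V} (h : G.Adj x y) :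
    edgeSpin G σ ⟨s(x, y), h⟩ = σ x * σ y := rfl

theorem edgeSpin_mul (η σ : V → ℤˣ) (e : G.edgeSet) :
    edgeSpin G (η * σ) e = edgeSpin G η e * edgeSpin G σ e := by
  obtain ⟨⟨x, y⟩, _⟩ := e
  exact mul_mul_mul_comm _ _ _ _

theorem edgeSpin_ne_of_mul_ne {u v : V} (huv : G.Reachable u v) {σ τ : V → ℤˣ}
    (h : σ u * σ v ≠ τ u * τ v) : ∃ e, edgeSpin G σ e ≠ edgeSpin G τ e := by
  contrapose! h
  obtain ⟨w⟩ := huv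
  induction w with
  | nil => simp only [Int.units_mul_self]
  | @cons a b c hab _ ih =>
    have hsplit : ∀ ρ : V → ℤˣ, ρ a * ρ c = ρ a * ρ b * (ρ b * ρ c) := fun ρ => by
      rw [mul_assoc, ← mul_assoc (ρ b), Int.units_mul_self, one_mul]
    rw [hsplit σ, hsplit τ, ih, ← edgeSpin_mk G σ hab, ← edgeSpin_mk G τ hab, h]

open Classical in
/-- The spin configuration that is `-1` on `A` and `1` elsewhere: multiplication by it flips the
spins in `A`. -/
noncomputable def flipSign (A : Set V) (x : V) : ℤˣ := if x ∈ A then -1 else 1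

theorem edgeSpin_flipSign_eq_neg_one {A : Set V} {x y : V} (h : G.Adj x y) :
    edgeSpin G (flipSign A) ⟨s(x, y), h⟩ = -1 ↔ ¬(x ∈ A ↔ y ∈ A) := by
  rw [edgeSpin_mk]
  unfold flipSign
  by_cases hx : x ∈ A <;> by_cases hy : y ∈ A <;> simp [hx, hy]

/-- The subgraph of the edges on which the multi-index `k` is odd. -/
def oddGraph (k : G.edgeSet → ℕ) : SimpleGraph V :=
  SimpleGraph.fromEdgeSet {e | ∃ h : e ∈ G.edgeSet, Odd (k ⟨e, h⟩)}

theorem oddGraph_adj {k : G.edgeSet → ℕ} {x y : V} :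
    (oddGraph G k).Adj x y ↔ ∃ h : G.Adj x y, Odd (k ⟨s(x, y), h⟩) := by
  rw [oddGraph, SimpleGraph.fromEdgeSet_adj]
  exact ⟨fun h => h.1, fun h => ⟨h, h.1.ne⟩⟩

variable [Fintype V] [DecidableRel G.Adj]

theorem hamiltonian_eq (J : G.edgeSet → ℝ) (σ : V → ℤˣ) :
    hamiltonian G J σ = ∑ e, J e * ((edgeSpin G σ e : ℤ) : ℝ) := rfl

theorem hamiltonian_gauge (η σ : V → ℤˣ) (J : G.edgeSet → ℝ) :
    hamiltonian G (edgeSpin G η • J) (η * σ) = hamiltonian G J σ := by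
  simp only [hamiltonian_eq, edgeSpin_mul, Pi.smul_apply', intUnit_smul_eq_mul]
  refine Finset.sum_congr rfl fun e _ => ?_
  push_cast
  linear_combination J e * ((edgeSpin G σ e : ℤ) : ℝ) * intUnit_cast_mul_self (edgeSpin G η e)

variable {G} in
theorem IsGroundState.gauge {J : G.edgeSet → ℝ} {σ : V → ℤˣ} (h : IsGroundState G J σ)
    (η : V → ℤˣ) : IsGroundState G (edgeSpin G η • J) (η * σ) := by
  intro τ
  rw [← mul_inv_cancel_left η τ, hamiltonian_gauge, hamiltonian_gauge]
  exact h _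

theorem isClosed_setOf_isGroundState (σ : V → ℤˣ) : IsClosed {J | IsGroundState G J σ} := by
  simp only [IsGroundState, hamiltonian_eq, Set.ofPred_forall]
  exact isClosed_iInter fun τ => isClosed_le (by fun_prop) (by fun_prop)

/-- The edges with exactly one endpoint in `A`. -/
noncomputable def edgeBoundary (A : Set V) : Finset G.edgeSet :=
  {e | edgeSpin G (flipSign A) e = -1}

variable {G}

theorem mem_edgeBoundary {A : Set V} {e : G.edgeSet} :
    e ∈ edgeBoundary G A ↔ edgeSpin G (flipSign A) e = -1 := by
  simp only [edgeBoundary, Finset.mem_filter_univ]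

theorem mk_mem_edgeBoundary {A : Set V} {x y : V} (h : G.Adj x y) :
    ⟨s(x, y), h⟩ ∈ edgeBoundary G A ↔ ¬(x ∈ A ↔ y ∈ A) :=
  mem_edgeBoundary.trans (edgeSpin_flipSign_eq_neg_one G h)

theorem exists_mem_of_mem_edgeBoundary {A : Set V} {e : G.edgeSet} (he : e ∈ edgeBoundary G A) :
    ∃ x ∈ A, x ∈ e.1 := by
  obtain ⟨⟨x, y⟩, h⟩ := e
  by_cases hx : x ∈ A
  · exact ⟨x, hx, Sym2.mem_mk_left x y⟩
  · have hy : y ∈ A := by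
      by_contra hy
      exact (mk_mem_edgeBoundary h).1 he (iff_of_false hx hy)
    exact ⟨y, hy, Sym2.mem_mk_right x y⟩

theorem IsGroundState.sum_edgeBoundary_nonneg {J : G.edgeSet → ℝ} {σ : V → ℤˣ}
    (h : IsGroundState G J σ) (A : Set V) :
    0 ≤ ∑ e ∈ edgeBoundary G A, J e * ((edgeSpin G σ e : ℤ) : ℝ) := by
  have hflip : ∀ e, (if edgeSpin G (flipSign A) e = -1 then J e * ((edgeSpin G σ e : ℤ) : ℝ)
      else 0) = (J e * ((edgeSpin G σ e : ℤ) : ℝ) -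
        J e * ((edgeSpin G (flipSign A * σ) e : ℤ) : ℝ)) / 2 := by
    intro e
    rw [edgeSpin_mul]
    rcases Int.units_eq_one_or (edgeSpin G (flipSign A) e) with hs | hs
    · rw [hs, if_neg (by decide), one_mul, sub_self, zero_div]
    · rw [hs, if_pos rfl]
      push_cast
      ring
  rw [edgeBoundary, Finset.sum_filter]
  simp only [hflip]
  rw [← Finset.sum_div, Finset.sum_sub_distrib, ← hamiltonian_eq, ← hamiltonian_eq]
  linarith [h (flipSign A * σ)]

theorem IsGroundState.mul_edgeSpin_pos_of_dominant {J : G.edgeSet → ℝ} {σ : V → ℤˣ}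
    (h : IsGroundState G J σ) {A : Set V} {e₀ : G.edgeSet} (he₀ : e₀ ∈ edgeBoundary G A)
    (hdom : ∑ e ∈ edgeBoundary G A, |J e| < 2 * |J e₀|) :
    0 < J e₀ * ((edgeSpin G σ e₀ : ℤ) : ℝ) := by
  classical
  have habs : ∀ e, |J e * ((edgeSpin G σ e : ℤ) : ℝ)| = |J e| := fun e => by
    rw [abs_mul, abs_intUnit_cast, mul_one]
  have hnonneg := h.sum_edgeBoundary_nonneg A
  have hothers : ∑ e ∈ (edgeBoundary G A).erase e₀, J e * ((edgeSpin G σ e : ℤ) : ℝ) ≤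
      ∑ e ∈ (edgeBoundary G A).erase e₀, |J e| :=
    Finset.sum_le_sum fun e _ => (le_abs_self _).trans (habs e).le
  rw [← Finset.add_sum_erase _ _ he₀] at hnonneg hdom
  by_contra! hnonpos
  have := habs e₀
  rw [abs_of_nonpos hnonpos] at this
  linarith

variable [DecidableEq V] (G)

theorem isGroundState_groundState (J : G.edgeSet → ℝ) : IsGroundState G J (groundState G J) :=
  Classical.choose_spec (exists_isGroundState G J)

theorem relativeSpin_congr (u v : V) {J J' : G.edgeSet → ℝ}
    (h : ∀ σ, IsGroundState G J σ ↔ IsGroundState G J' σ) :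
    relativeSpin G u v J = relativeSpin G u v J' := by
  have hpred : IsGroundState G J = IsGroundState G J' := funext fun σ => propext (h σ)
  have hground : groundState G J = groundState G J' := by
    unfold groundState
    congr 1
  rw [relativeSpin, hground, relativeSpin]

theorem abs_relativeSpin (u v : V) (J : G.edgeSet → ℝ) : |relativeSpin G u v J| = 1 :=
  abs_intUnit_cast _

theorem ae_relativeSpin_unique {u v : V} (huv : G.Reachable u v) :
    ∀ᵐ J ∂(couplingLaw G), ∀ σ, IsGroundState G J σ →
      relativeSpin G u v J = ((σ u * σ v : ℤˣ) : ℤ) := by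
  have hpair : ∀ᵐ J ∂(couplingLaw G), ∀ σ τ, IsGroundState G J σ → IsGroundState G J τ →
      σ u * σ v = τ u * τ v := by
    refine ae_all_iff.2 fun σ => ae_all_iff.2 fun τ => ?_
    by_cases h : σ u * σ v = τ u * τ v
    · exact ae_of_all _ fun _ _ _ => h
    obtain ⟨e, he⟩ := edgeSpin_ne_of_mul_ne G huv h
    have hnull := stdGaussianPi_hyperplane_eq_zero
      (c := fun e => ((edgeSpin G σ e : ℤ) : ℝ) - ((edgeSpin G τ e : ℤ) : ℝ)) fun h0 => he <| by
        simpa only [Pi.zero_apply, sub_eq_zero, Int.cast_inj, Units.val_inj] using congrFun h0 e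
    filter_upwards [measure_eq_zero_iff_ae_notMem.1 hnull] with J hJ hσ hτ
    have henergy := le_antisymm (hτ σ) (hσ τ)
    simp only [hamiltonian_eq, mul_comm (J _)] at henergy
    refine absurd ?_ hJ
    simp only [sub_mul, Finset.sum_sub_distrib, henergy, sub_self]
  filter_upwards [hpair] with J hJ σ hσ
  rw [relativeSpin, hJ _ _ (isGroundState_groundState G J) hσ]

theorem ae_relativeSpin_gauge {u v : V} (huv : G.Reachable u v) (η : V → ℤˣ) :
    ∀ᵐ J ∂(couplingLaw G), relativeSpin G u v (edgeSpin G η • J) =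
      (((η u * η v : ℤˣ) : ℤ) : ℝ) * relativeSpin G u v J := by
  filter_upwards [(measurePreserving_intUnit_smul (edgeSpin G η)).quasiMeasurePreserving.ae
    (ae_relativeSpin_unique G huv)] with J hJ
  rw [hJ _ ((isGroundState_groundState G J).gauge η), relativeSpin, ← Int.cast_mul,
    ← Units.val_mul, Pi.mul_apply, Pi.mul_apply, mul_mul_mul_comm]

theorem aestronglyMeasurable_relativeSpin {u v : V} (huv : G.Reachable u v) :
    AEStronglyMeasurable (relativeSpin G u v) (couplingLaw G) := by
  classical
  let A : Set (G.edgeSet → ℝ) := ⋃ σ ∈ {σ : V → ℤˣ | σ u * σ v = 1}, {J | IsGroundState G J σ}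
  have hA : MeasurableSet A := MeasurableSet.biUnion (Set.to_countable _)
    fun σ _ => (isClosed_setOf_isGroundState G σ).measurableSet
  refine ⟨fun J => if J ∈ A then 1 else -1,
    (Measurable.ite hA measurable_const measurable_const).stronglyMeasurable, ?_⟩
  filter_upwards [ae_relativeSpin_unique G huv] with J hJ
  split_ifs with h
  · obtain ⟨σ, hσ, hJσ⟩ := Set.mem_iUnion₂.1 h
    rw [hJ σ hJσ, show σ u * σ v = 1 from hσ]
    simp
  · have hne : groundState G J u * groundState G J v ≠ 1 := fun h1 =>
      h (Set.mem_biUnion h1 (isGroundState_groundState G J))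
    rw [relativeSpin, (Int.units_eq_one_or _).resolve_left hne]
    simp

theorem memLp_indicator_relativeSpin {u v : V} (huv : G.Reachable u v)
    {A : Set (G.edgeSet → ℝ)} (hA : MeasurableSet A) :
    MemLp (A.indicator (relativeSpin G u v)) 2 (couplingLaw G) := by
  have : IsProbabilityMeasure (couplingLaw G) := by unfold couplingLaw; infer_instance
  refine MemLp.of_bound ((aestronglyMeasurable_relativeSpin G huv).indicator hA) 1
    (ae_of_all _ fun J => ?_)
  by_cases h : J ∈ A <;> simp [h, abs_relativeSpin]

theorem fourierCoeff_eq (u v : V) (k : G.edgeSet → ℕ) :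
    fourierCoeff G u v k =
      ∫ J, relativeSpin G u v J * hermitePi k J ∂(stdGaussianPi G.edgeSet) := rfl

theorem reachable_oddGraph_of_fourierCoeff_ne_zero {u v : V} (huv : G.Reachable u v)
    {k : G.edgeSet → ℕ} (hk : fourierCoeff G u v k ≠ 0) : (oddGraph G k).Reachable u v := by
  contrapose! hk
  set η := flipSign {x | (oddGraph G k).Reachable u x} with hη
  have hfixed : ∀ x y (h : G.Adj x y),
      edgeSpin G η ⟨s(x, y), h⟩ ^ k ⟨s(x, y), h⟩ = 1 := fun x y h => by
    rcases Nat.even_or_odd (k ⟨s(x, y), h⟩) with heven | hodd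
    · rw [Int.units_pow_eq_pow_mod_two, Nat.even_iff.1 heven, pow_zero]
    · have hxy : (oddGraph G k).Reachable x y := ((oddGraph_adj G).2 ⟨h, hodd⟩).reachable
      have hsame : edgeSpin G η ⟨s(x, y), h⟩ ≠ -1 := mt (edgeSpin_flipSign_eq_neg_one G h).1
        (not_not.2 ⟨fun hx => hx.trans hxy, fun hy => hy.trans hxy.symm⟩)
      rw [(Int.units_eq_one_or _).resolve_right hsame, one_pow]
  refine integral_mul_hermitePi_eq_zero (s := edgeSpin G η) (ae_relativeSpin_gauge G huv η) ?_
  rw [Finset.prod_eq_one (by rintro ⟨⟨x, y⟩, h⟩ -; exact hfixed x y h), mul_one]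
  simp [hη, flipSign, hk]

end GroundStates

/-! ### Shielded four-cycles -/

section Squares

/-- A lower bound for the probability that a standard Gaussian coupling is strong (larger than `N`
in absolute value), respectively weak. -/
noncomputable def shieldProb (N : ℕ) : ENNReal :=
  min (gaussianReal 0 1 {x | (N : ℝ) < |x|}) (gaussianReal 0 1 {x | |x| ≤ 1})

theorem shieldProb_pos (N : ℕ) : 0 < shieldProb N := by
  have hpos : ∀ {s t : Set ℝ}, IsOpen t → t.Nonempty → t ⊆ s → 0 < gaussianReal 0 1 s :=
    fun ht hne hts => pos_iff_ne_zero.2 fun h0 => ht.measure_ne_zero volume hne <|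
      gaussianReal_absolutelyContinuous' 0 one_ne_zero (measure_mono_null hts h0)
  refine lt_min (hpos (isOpen_Ioi (a := (N : ℝ))) Set.nonempty_Ioi fun x hx => ?_)
    (hpos (isOpen_Ioo (a := -1) (b := 1)) ⟨0, by norm_num⟩ fun x hx => ?_)
  · exact hx.trans_le (le_abs_self x)
  · exact abs_le.2 ⟨hx.1.le, hx.2.le⟩

theorem shieldProb_le_one (N : ℕ) : shieldProb N ≤ 1 := (min_le_left _ _).trans prob_le_one

variable {V : Type*} {G : SimpleGraph V}

variable (G) in
/-- A four-cycle in `G` with the edges `ab`, `bd`, `dc`, `ca`. -/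
structure FourCycle where
  (a b c d : V)
  hab : G.Adj a b
  hac : G.Adj a c
  hbd : G.Adj b d
  hcd : G.Adj c d
  had : a ≠ d
  hbc : b ≠ c

namespace FourCycle

variable (Q : FourCycle G)

/-- The edge from `a` to `b`: the one whose coupling has its sign flipped. -/
def ab : G.edgeSet := ⟨s(Q.a, Q.b), Q.hab⟩

/-- The edge from `a` to `c`. -/
def ac : G.edgeSet := ⟨s(Q.a, Q.c), Q.hac⟩

/-- The edge from `b` to `d`. -/
def bd : G.edgeSet := ⟨s(Q.b, Q.d), Q.hbd⟩

/-- The edge from `c` to `d`. -/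
def cd : G.edgeSet := ⟨s(Q.c, Q.d), Q.hcd⟩

/-- The set of vertices of the cycle. -/
def verts : Set V := {Q.a, Q.b, Q.c, Q.d}

/-- The three edges of the cycle whose couplings shield the edge `ab`. -/
def strong : Set G.edgeSet := {Q.ac, Q.bd, Q.cd}

theorem ab_notMem_strong : Q.ab ∉ Q.strong := by
  simp [strong, ab, ac, bd, cd, Subtype.ext_iff, Q.hab.ne, Q.hab.ne', Q.hac.ne, Q.hbc,
    Q.had]

theorem edgeSpin_ab (σ : V → ℤˣ) :
    edgeSpin G σ Q.ab = edgeSpin G σ Q.ac * edgeSpin G σ Q.cd * edgeSpin G σ Q.bd := by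
  change σ Q.a * σ Q.b = σ Q.a * σ Q.c * (σ Q.c * σ Q.d) * (σ Q.b * σ Q.d)
  rcases Int.units_eq_one_or (σ Q.c) with hc | hc <;>
    rcases Int.units_eq_one_or (σ Q.d) with hd | hd <;> simp [hc, hd]

open Classical in
/-- The sign pattern whose action on the couplings changes the sign of the one on `ab` only. -/
noncomputable def abSign : G.edgeSet → ℤˣ := Pi.mulSingle Q.ab (-1)

theorem abSign_smul_of_ne (J : G.edgeSet → ℝ) {e : G.edgeSet} (he : e ≠ Q.ab) :
    (Q.abSign • J) e = J e := by
  classical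
  rw [Pi.smul_apply', abSign, Pi.mulSingle_eq_of_ne he, one_smul]

variable [Fintype V] [DecidableRel G.Adj]

open Classical in
/-- The edges that touch the cycle. -/
noncomputable def block : Finset G.edgeSet := {e | ∃ x ∈ Q.verts, x ∈ e.1}

theorem mem_block {e : G.edgeSet} : e ∈ Q.block ↔ ∃ x ∈ Q.verts, x ∈ e.1 := by
  classical exact Finset.mem_filter_univ _

theorem card_block_le {Δ : ℕ} (hdeg : ∀ x, G.degree x ≤ Δ) : Q.block.card ≤ 4 * Δ := by
  classical
  have hsub : Q.block.map (Function.Embedding.subtype _) ⊆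
      ({Q.a, Q.b, Q.c, Q.d} : Finset V).biUnion (G.incidenceFinset ·) := by
    intro _ he
    obtain ⟨e, hblock, rfl⟩ := Finset.mem_map.1 he
    obtain ⟨x, hx, hxe⟩ := Q.mem_block.1 hblock
    refine Finset.mem_biUnion.2 ⟨x, by simpa [verts] using hx, ?_⟩
    exact (G.mem_incidenceFinset x _).2 ⟨e.2, hxe⟩
  calc Q.block.card = (Q.block.map (Function.Embedding.subtype _)).card := (Finset.card_map _).symm
    _ ≤ _ := Finset.card_le_card hsub
    _ ≤ ({Q.a, Q.b, Q.c, Q.d} : Finset V).card * Δ := Finset.card_biUnion_le_card_mul _ _ _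
        fun x _ => (G.card_incidenceFinset_eq_degree x).trans_le (hdeg x)
    _ ≤ 4 * Δ := Nat.mul_le_mul_right Δ Finset.card_le_four

open Classical in
/-- The range of the coupling of an edge in the event that the cycle is shielded: the couplings of
the edges `ac`, `cd`, `bd` dominate the total contribution of the weak edges touching the cycle. -/
def couplingRange (e : G.edgeSet) : Set ℝ :=
  if e ∈ Q.strong then {x | (Q.block.card : ℝ) < |x|} else {x | |x| ≤ 1}

theorem couplingRange_of_mem {e : G.edgeSet} (he : e ∈ Q.strong) :
    Q.couplingRange e = {x | (Q.block.card : ℝ) < |x|} := if_pos he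

theorem couplingRange_of_notMem {e : G.edgeSet} (he : e ∉ Q.strong) :
    Q.couplingRange e = {x | |x| ≤ 1} := if_neg he

theorem measurableSet_couplingRange (e : G.edgeSet) : MeasurableSet (Q.couplingRange e) := by
  unfold couplingRange
  split_ifs
  · exact measurableSet_lt measurable_const (by fun_prop)
  · exact measurableSet_le (by fun_prop) measurable_const

/-- The event that the couplings of `ac`, `cd`, `bd` are strong and those of all other edges
touching the cycle are weak. -/
def shieldEvent : Set (G.edgeSet → ℝ) := (Q.block : Set G.edgeSet).pi Q.couplingRange

theorem measurableSet_shieldEvent : MeasurableSet Q.shieldEvent :=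
  MeasurableSet.pi (Set.to_countable _) fun e _ => Q.measurableSet_couplingRange e

theorem measure_compl_shieldEvent_le {N : ℕ} (hN : Q.block.card ≤ N) :
    stdGaussianPi G.edgeSet Q.shieldEventᶜ ≤ 1 - shieldProb N ^ N := by
  rw [prob_compl_eq_one_sub Q.measurableSet_shieldEvent]
  refine tsub_le_tsub_left ?_ _
  calc shieldProb N ^ N ≤ shieldProb N ^ Q.block.card :=
        pow_le_pow_right_of_le_one' (shieldProb_le_one N) hN
    _ ≤ stdGaussianPi G.edgeSet Q.shieldEvent := pow_card_le_measure_pi _ _ fun e _ => ?_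
  by_cases he : e ∈ Q.strong
  · rw [Q.couplingRange_of_mem he]
    refine (min_le_left _ _).trans (measure_mono fun x hx => ?_)
    exact (Nat.cast_le.2 hN).trans_lt (Set.mem_ofPred.1 hx)
  · rw [Q.couplingRange_of_notMem he]
    exact min_le_right _ _

theorem intUnit_smul_mem_shieldEvent {s : G.edgeSet → ℤˣ} {J : G.edgeSet → ℝ} :
    s • J ∈ Q.shieldEvent ↔ J ∈ Q.shieldEvent := by
  refine forall₂_congr fun e _ => ?_
  by_cases he : e ∈ Q.strong
  · simp only [Q.couplingRange_of_mem he, Set.mem_ofPred_eq, Pi.smul_apply', abs_intUnit_smul]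
  · simp only [Q.couplingRange_of_notMem he, Set.mem_ofPred_eq, Pi.smul_apply', abs_intUnit_smul]

variable {Q}

theorem mul_edgeSpin_pos_of_edgeBoundary {J : G.edgeSet → ℝ} (hJ : J ∈ Q.shieldEvent)
    {σ : V → ℤˣ} (hσ : IsGroundState G J σ) {A : Set V} (hA : A ⊆ Q.verts) {e₀ : G.edgeSet}
    (he₀ : e₀ ∈ Q.strong) (honly : ∀ e ∈ Q.strong, e ∈ edgeBoundary G A ↔ e = e₀) :
    0 < J e₀ * ((edgeSpin G σ e₀ : ℤ) : ℝ) := by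
  classical
  have hblock : edgeBoundary G A ⊆ Q.block := fun e he => by
    obtain ⟨x, hx, hxe⟩ := exists_mem_of_mem_edgeBoundary he
    exact Q.mem_block.2 ⟨x, hA hx, hxe⟩
  have hmem : e₀ ∈ edgeBoundary G A := (honly e₀ he₀).2 rfl
  have hstrong : (Q.block.card : ℝ) < |J e₀| := by
    have := hJ e₀ (hblock hmem)
    rwa [Q.couplingRange_of_mem he₀] at this
  have hweak : ∀ e ∈ (edgeBoundary G A).erase e₀, |J e| ≤ 1 := fun e he => by
    obtain ⟨hne, he⟩ := Finset.mem_erase.1 he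
    have := hJ e (hblock he)
    rwa [Q.couplingRange_of_notMem fun h => hne ((honly e h).1 he)] at this
  refine hσ.mul_edgeSpin_pos_of_dominant hmem ?_
  rw [← Finset.add_sum_erase _ _ hmem, two_mul, add_lt_add_iff_left]
  calc ∑ e ∈ (edgeBoundary G A).erase e₀, |J e|
      ≤ ((edgeBoundary G A).erase e₀).card := by
        simpa only [nsmul_eq_mul, mul_one] using Finset.sum_le_card_nsmul _ _ _ hweak
    _ ≤ Q.block.card := mod_cast Finset.card_le_card ((Finset.erase_subset _ _).trans hblock)
    _ < |J e₀| := hstrong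

theorem mul_edgeSpin_pos_of_mem_strong {J : G.edgeSet → ℝ} (hJ : J ∈ Q.shieldEvent)
    {σ : V → ℤˣ} (hσ : IsGroundState G J σ) {e : G.edgeSet} (he : e ∈ Q.strong) :
    0 < J e * ((edgeSpin G σ e : ℤ) : ℝ) := by
  suffices h : ∃ A ⊆ Q.verts, ∀ e' ∈ Q.strong, e' ∈ edgeBoundary G A ↔ e' = e by
    obtain ⟨A, hA, honly⟩ := h
    exact mul_edgeSpin_pos_of_edgeBoundary hJ hσ hA he honly
  rcases he with rfl | rfl | rfl
  · refine ⟨{Q.a}, by simp [verts], ?_⟩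
    rintro e' (rfl | rfl | rfl) <;>
      simp [ac, bd, cd, mk_mem_edgeBoundary, Subtype.ext_iff, Q.hab.ne', Q.hac.ne',
        Q.had.symm]
  · refine ⟨{Q.b}, by simp [verts], ?_⟩
    rintro e' (rfl | rfl | rfl) <;>
      simp [ac, bd, cd, mk_mem_edgeBoundary, Subtype.ext_iff, Q.hab.ne, Q.hbc.symm,
        Q.hbd.ne', Q.had]
  · refine ⟨{Q.a, Q.c}, by simp [verts, Set.insert_subset_iff], ?_⟩
    rintro e' (rfl | rfl | rfl) <;>
      simp [ac, bd, cd, mk_mem_edgeBoundary, Subtype.ext_iff, Q.hab.ne', Q.hac.ne, Q.hcd.ne',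
        Q.hbc, Q.had, Q.had.symm]

theorem edgeSpin_ab_eq {J J' : G.edgeSet → ℝ} (hJ : J ∈ Q.shieldEvent) (hJ' : J' ∈ Q.shieldEvent)
    (heq : ∀ e ≠ Q.ab, J e = J' e) {σ τ : V → ℤˣ} (hσ : IsGroundState G J σ)
    (hτ : IsGroundState G J' τ) : edgeSpin G σ Q.ab = edgeSpin G τ Q.ab := by
  have hstrong : ∀ e ∈ Q.strong, edgeSpin G σ e = edgeSpin G τ e := fun e he => by
    have hpos := mul_edgeSpin_pos_of_mem_strong hJ hσ he
    have hpos' := mul_edgeSpin_pos_of_mem_strong hJ' hτ he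
    rw [← heq e fun h => Q.ab_notMem_strong (h ▸ he)] at hpos'
    rcases Int.units_eq_one_or (edgeSpin G σ e) with h | h <;>
      rcases Int.units_eq_one_or (edgeSpin G τ e) with h' | h' <;>
      simp only [h, h', Units.val_one, Units.val_neg, Int.cast_one, Int.cast_neg] at hpos hpos' ⊢
    all_goals linarith
  rw [edgeSpin_ab, edgeSpin_ab, hstrong _ (.inl rfl), hstrong _ (.inr (.inl rfl)),
    hstrong _ (.inr (.inr rfl))]

theorem isGroundState_of_shielded {J J' : G.edgeSet → ℝ}
    (hJ : J ∈ Q.shieldEvent) (hJ' : J' ∈ Q.shieldEvent) (heq : ∀ e ≠ Q.ab, J e = J' e)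
    {σ : V → ℤˣ} (hσ : IsGroundState G J σ) : IsGroundState G J' σ := by
  classical
  obtain ⟨τ, hτ⟩ := exists_isGroundState G J'
  have hdiff : ∀ ρ, hamiltonian G J' ρ - hamiltonian G J ρ =
      (J' Q.ab - J Q.ab) * ((edgeSpin G ρ Q.ab : ℤ) : ℝ) := fun ρ => by
    simp only [hamiltonian_eq, ← Finset.sum_sub_distrib, ← sub_mul]
    refine Finset.sum_eq_single_of_mem Q.ab (Finset.mem_univ _) fun e _ he => ?_
    rw [heq e he, sub_self, zero_mul]
  have hστ : hamiltonian G J' τ ≤ hamiltonian G J' σ := by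
    have hσ' := hdiff σ
    rw [edgeSpin_ab_eq hJ hJ' heq hσ hτ] at hσ'
    linarith [hdiff τ, hσ τ]
  exact fun ρ => (hτ ρ).trans hστ

theorem prod_abSign_pow {k : G.edgeSet → ℕ} (hk : Odd (k Q.ab)) :
    ∏ e, Q.abSign e ^ k e = -1 := by
  classical
  rw [Fintype.prod_eq_single Q.ab fun e he => by
    rw [abSign, Pi.mulSingle_eq_of_ne he, one_pow], abSign, Pi.mulSingle_eq_same, hk.neg_one_pow]

variable [DecidableEq V]

theorem relativeSpin_abSign_smul (u v : V) {J : G.edgeSet → ℝ} (hJ : J ∈ Q.shieldEvent) :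
    relativeSpin G u v (Q.abSign • J) = relativeSpin G u v J := by
  have hJ' := (Q.intUnit_smul_mem_shieldEvent (s := Q.abSign)).2 hJ
  exact relativeSpin_congr G u v fun σ =>
    ⟨isGroundState_of_shielded hJ' hJ fun e he => Q.abSign_smul_of_ne J he,
      isGroundState_of_shielded hJ hJ' fun e he => (Q.abSign_smul_of_ne J he).symm⟩

theorem integral_indicator_shieldEvent_eq_zero (u v : V) {k : G.edgeSet → ℕ} (hk : Odd (k Q.ab))
    {A : Set (G.edgeSet → ℝ)} (hA : ∀ J, Q.abSign • J ∈ A ↔ J ∈ A) :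
    ∫ J, (A ∩ Q.shieldEvent).indicator (relativeSpin G u v) J * hermitePi k J
      ∂(stdGaussianPi G.edgeSet) = 0 := by
  refine integral_mul_hermitePi_eq_zero (s := Q.abSign) (ε := 1) (ae_of_all _ fun J => ?_)
    (by rw [prod_abSign_pow hk, one_mul])
  have hmem : Q.abSign • J ∈ A ∩ Q.shieldEvent ↔ J ∈ A ∩ Q.shieldEvent :=
    and_congr (hA J) Q.intUnit_smul_mem_shieldEvent
  rw [Units.val_one, Int.cast_one, one_mul]
  by_cases hJ : J ∈ A ∩ Q.shieldEvent
  · rw [Set.indicator_of_mem hJ, Set.indicator_of_mem (hmem.2 hJ),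
      relativeSpin_abSign_smul u v hJ.2]
  · rw [Set.indicator_of_notMem hJ, Set.indicator_of_notMem (mt hmem.1 hJ)]

end FourCycle

variable [Fintype V] [DecidableRel G.Adj] [DecidableEq V]

theorem fourierCoeff_eq_integral_indicator_of_odd {u v : V} (huv : G.Reachable u v) {κ : Type*}
    (t : Finset κ) (Q : κ → FourCycle G) {k : G.edgeSet → ℕ} (hk : ∀ j ∈ t, Odd (k (Q j).ab)) :
    fourierCoeff G u v k =
      ∫ J, (⋂ j ∈ t, ((Q j).shieldEvent)ᶜ).indicator (relativeSpin G u v) J * hermitePi k J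
        ∂(stdGaussianPi G.edgeSet) := by
  classical
  induction t using Finset.induction_on with
  | empty => simp only [Finset.notMem_empty, Set.iInter_of_empty, Set.iInter_univ,
      Set.indicator_univ, fourierCoeff_eq]
  | insert j t _ ih =>
    rw [Finset.forall_mem_insert] at hk
    rw [ih hk.2, Finset.set_biInter_insert, Set.inter_comm]
    set A : Set (G.edgeSet → ℝ) := ⋂ i ∈ t, ((Q i).shieldEvent)ᶜ with hA
    have hAm : MeasurableSet A :=
      Finset.measurableSet_biInter _ fun i _ => (Q i).measurableSet_shieldEvent.compl
    have hAinv : ∀ J, (Q j).abSign • J ∈ A ↔ J ∈ A := fun J => by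
      simp only [hA, Set.mem_iInter, Set.mem_compl_iff, FourCycle.intUnit_smul_mem_shieldEvent]
    have hint : ∀ {B : Set (G.edgeSet → ℝ)}, MeasurableSet B →
        Integrable (fun J => B.indicator (relativeSpin G u v) J * hermitePi k J)
          (stdGaussianPi G.edgeSet) := fun hB =>
      (memLp_indicator_relativeSpin G huv hB).integrable_mul (memLp_hermitePi k)
    have hsm := (Q j).measurableSet_shieldEvent
    calc ∫ J, A.indicator (relativeSpin G u v) J * hermitePi k J ∂(stdGaussianPi G.edgeSet)
        = ∫ J, ((A ∩ (Q j).shieldEvent).indicator (relativeSpin G u v) J * hermitePi k J +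
            (A ∩ (Q j).shieldEventᶜ).indicator (relativeSpin G u v) J * hermitePi k J)
            ∂(stdGaussianPi G.edgeSet) := by
          refine integral_congr_ae (ae_of_all _ fun J => ?_)
          by_cases h : J ∈ (Q j).shieldEvent <;> by_cases h' : J ∈ A <;> simp [h, h']
      _ = _ := by
          rw [integral_add (hint (hAm.inter hsm)) (hint (hAm.inter hsm.compl)),
            FourCycle.integral_indicator_shieldEvent_eq_zero u v hk.1 hAinv, zero_add]

theorem tsum_sq_fourierCoeff_le_of_odd {N : ℕ} {u v : V} (huv : G.Reachable u v) {κ : Type*}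
    [Fintype κ] (Q : κ → FourCycle G) (hN : ∀ j, (Q j).block.card ≤ N)
    (hQ : Pairwise (Function.onFun Disjoint fun j => (Q j).block)) :
    ∑' k : {k : G.edgeSet → ℕ | ∀ j, Odd (k (Q j).ab)},
      ENNReal.ofReal (fourierCoeff G u v k.1 ^ 2) ≤
        (1 - shieldProb N ^ N) ^ Fintype.card κ := by
  set A : Set (G.edgeSet → ℝ) := ⋂ j, ((Q j).shieldEvent)ᶜ
  have hAm : MeasurableSet A :=
    MeasurableSet.iInter fun j => (Q j).measurableSet_shieldEvent.compl
  have hcoeff : ∀ k : {k : G.edgeSet → ℕ | ∀ j, Odd (k (Q j).ab)}, fourierCoeff G u v k.1 =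
      ∫ J, A.indicator (relativeSpin G u v) J * hermitePi k.1 J ∂(stdGaussianPi G.edgeSet) :=
    fun k => by
      rw [fourierCoeff_eq_integral_indicator_of_odd huv Finset.univ Q fun j _ => k.2 j]
      simp only [Finset.mem_univ, Set.iInter_true, A]
  have hsq : (fun J => A.indicator (relativeSpin G u v) J ^ 2) = A.indicator 1 := by
    funext J
    by_cases hJ : J ∈ A <;> simp [hJ, ← sq_abs (relativeSpin G u v J), abs_relativeSpin]
  calc ∑' k : {k : G.edgeSet → ℕ | ∀ j, Odd (k (Q j).ab)},
        ENNReal.ofReal (fourierCoeff G u v k.1 ^ 2)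
      ≤ ENNReal.ofReal (∫ J, A.indicator (relativeSpin G u v) J ^ 2
          ∂(stdGaussianPi G.edgeSet)) := by
        simp only [hcoeff]
        exact tsum_sq_integral_mul_hermitePi_le (memLp_indicator_relativeSpin G huv hAm) _
    _ = stdGaussianPi G.edgeSet A := by rw [hsq, integral_indicator_one hAm, ofReal_measureReal]
    _ ≤ (1 - shieldProb N ^ N) ^ Fintype.card κ :=
        measure_iInter_compl_pi_le _ (fun j => (Q j).measurableSet_couplingRange) hQ
          fun j => (Q j).measure_compl_shieldEvent_le (hN j)

end Squares

/-! ### Squares of the grid -/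

section Grid

variable {n : ℕ}

theorem grid_adj {p q : GridVertex n} :
    (grid n).Adj p q ↔ (p.1.1 - q.1.1).natAbs + (p.1.2 - q.1.2).natAbs = 1 := by
  change |p.1.1 - q.1.1| + |p.1.2 - q.1.2| = 1 ↔ _
  rw [Int.abs_eq_natAbs, Int.abs_eq_natAbs]
  exact_mod_cast Iff.rfl

theorem gridVertex_bounds (p : GridVertex n) :
    1 ≤ p.1.1 ∧ p.1.1 ≤ n ∧ 1 ≤ p.1.2 ∧ p.1.2 ≤ n := by
  simpa only [Finset.mem_product, Finset.mem_Icc, and_assoc] using p.2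

theorem mem_gridVertex_iff {x y : ℤ} :
    (x, y) ∈ Finset.Icc (1 : ℤ) n ×ˢ Finset.Icc (1 : ℤ) n ↔
      1 ≤ x ∧ x ≤ n ∧ 1 ≤ y ∧ y ≤ n := by
  simp only [Finset.mem_product, Finset.mem_Icc, and_assoc]

theorem degree_grid_le (p : GridVertex n) : (grid n).degree p ≤ 4 := by
  rw [← SimpleGraph.card_neighborFinset_eq_degree,
    ← Finset.card_image_of_injective _ Subtype.val_injective]
  have hsub : ((grid n).neighborFinset p).image Subtype.val ⊆
      {(p.1.1 + 1, p.1.2), (p.1.1 - 1, p.1.2), (p.1.1, p.1.2 + 1), (p.1.1, p.1.2 - 1)} := by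
    refine Finset.image_subset_iff.2 fun q hq => ?_
    rw [SimpleGraph.mem_neighborFinset, grid_adj] at hq
    simp only [Finset.mem_insert, Finset.mem_singleton, Prod.ext_iff]
    omega
  exact (Finset.card_le_card hsub).trans Finset.card_le_four

theorem exists_grid_adj_of_ne {p q : GridVertex n} (h : p ≠ q) :
    ∃ r, (grid n).Adj p r ∧ (r.1.1 - q.1.1).natAbs + (r.1.2 - q.1.2).natAbs + 1 =
      (p.1.1 - q.1.1).natAbs + (p.1.2 - q.1.2).natAbs := by
  have hp := gridVertex_bounds p
  have hq := gridVertex_bounds q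
  have hcases : p.1.1 < q.1.1 ∨ q.1.1 < p.1.1 ∨ p.1.2 < q.1.2 ∨ q.1.2 < p.1.2 := by
    rw [Ne, Subtype.ext_iff, Prod.ext_iff] at h
    omega
  simp only [grid_adj]
  rcases hcases with h | h | h | h
  · exact ⟨⟨(p.1.1 + 1, p.1.2), mem_gridVertex_iff.2 (by omega)⟩,
      by dsimp only; omega, by dsimp only; omega⟩
  · exact ⟨⟨(p.1.1 - 1, p.1.2), mem_gridVertex_iff.2 (by omega)⟩,
      by dsimp only; omega, by dsimp only; omega⟩
  · exact ⟨⟨(p.1.1, p.1.2 + 1), mem_gridVertex_iff.2 (by omega)⟩,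
      by dsimp only; omega, by dsimp only; omega⟩
  · exact ⟨⟨(p.1.1, p.1.2 - 1), mem_gridVertex_iff.2 (by omega)⟩,
      by dsimp only; omega, by dsimp only; omega⟩

theorem grid_preconnected : (grid n).Preconnected := by
  intro p q
  induction hd : (p.1.1 - q.1.1).natAbs + (p.1.2 - q.1.2).natAbs using Nat.strong_induction_on
    generalizing p with
  | _ d ih =>
    by_cases hpq : p = q
    · exact hpq ▸ SimpleGraph.Reachable.refl p
    · obtain ⟨r, hpr, hr⟩ := exists_grid_adj_of_ne hpq
      exact hpr.reachable.trans (ih _ (by omega) r rfl)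

/-- The unit square with the horizontal edge from `p` to its right neighbor as distinguished edge
`ab`. It lies above that edge, or below it if `p` is in the top row. -/
def gridSquare (p : GridVertex n) (hp : p.1.1 < n) : FourCycle (grid n) where
  a := p
  b := ⟨(p.1.1 + 1, p.1.2), mem_gridVertex_iff.2 (by have := gridVertex_bounds p; omega)⟩
  c := ⟨(p.1.1, if p.1.2 < n then p.1.2 + 1 else p.1.2 - 1),
    mem_gridVertex_iff.2 (by have := gridVertex_bounds p; split_ifs <;> omega)⟩
  d := ⟨(p.1.1 + 1, if p.1.2 < n then p.1.2 + 1 else p.1.2 - 1),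
    mem_gridVertex_iff.2 (by have := gridVertex_bounds p; split_ifs <;> omega)⟩
  hab := by rw [grid_adj]; simp
  hac := by rw [grid_adj]; split_ifs <;> simp
  hbd := by rw [grid_adj]; split_ifs <;> simp
  hcd := by rw [grid_adj]; simp
  had h := by simp [Subtype.ext_iff, Prod.ext_iff] at h
  hbc h := by simp [Subtype.ext_iff, Prod.ext_iff] at h

theorem mem_verts_gridSquare {p q : GridVertex n} {hp : p.1.1 < n}
    (hq : q ∈ (gridSquare p hp).verts) : p.1.1 ≤ q.1.1 ∧ q.1.1 ≤ p.1.1 + 1 := by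
  rcases hq with rfl | rfl | rfl | rfl
  exacts [⟨le_rfl, Int.le_add_one le_rfl⟩, ⟨Int.le_add_one le_rfl, le_rfl⟩,
    ⟨le_rfl, Int.le_add_one le_rfl⟩, ⟨Int.le_add_one le_rfl, le_rfl⟩]

theorem natAbs_sub_le_one_of_mem_edge {e : (grid n).edgeSet} {p q : GridVertex n} (hp : p ∈ e.1)
    (hq : q ∈ e.1) : (p.1.1 - q.1.1).natAbs ≤ 1 := by
  obtain ⟨⟨a, b⟩, he⟩ := e
  have hab := grid_adj.1 (show (grid n).Adj a b from he)
  rcases Sym2.mem_iff.1 hp with rfl | rfl <;> rcases Sym2.mem_iff.1 hq with rfl | rfl <;> omega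

theorem disjoint_block_gridSquare {p q : GridVertex n} (hp : p.1.1 < n) (hq : q.1.1 < n)
    (h : 3 ≤ (p.1.1 - q.1.1).natAbs) :
    Disjoint (gridSquare p hp).block (gridSquare q hq).block := by
  refine Finset.disjoint_left.2 fun e he he' => ?_
  obtain ⟨a, ha, hae⟩ := (FourCycle.mem_block _).1 he
  obtain ⟨b, hb, hbe⟩ := (FourCycle.mem_block _).1 he'
  have := mem_verts_gridSquare ha
  have := mem_verts_gridSquare hb
  have := natAbs_sub_le_one_of_mem_edge hae hbe
  omega

end Grid

/-! ### Column crossings -/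

section Heights

/-- The total variation `|y - l₁| + |l₁ - l₂| + ⋯ + |lₖ - y'|` of a list of heights `l` with
prescribed start `y` and end `y'`. -/
def heightVariation : ℤ → List ℤ → ℤ → ℕ
  | y, [], y' => (y - y').natAbs
  | y, a :: l, y' => (y - a).natAbs + heightVariation a l y'

theorem heightVariation_le_natAbs_add (y z : ℤ) (l : List ℤ) (y' : ℤ) :
    heightVariation y l y' ≤ (y - z).natAbs + heightVariation z l y' := by
  cases l <;> simp only [heightVariation] <;> omega

theorem even_heightVariation_iff (y : ℤ) (l : List ℤ) (y' : ℤ) :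
    Even (heightVariation y l y') ↔ Even (y - y') := by
  induction l generalizing y with
  | nil => simp only [heightVariation, Int.natAbs_even]
  | cons a l ih =>
    rw [heightVariation, Nat.even_add, ih, Int.natAbs_even, ← Int.even_add, sub_add_sub_cancel]

/-- The lists of length `k` with entries in `s`. -/
def heightLists (s : Finset ℤ) : ℕ → Finset (List ℤ)
  | 0 => {[]}
  | k + 1 => (s ×ˢ heightLists s k).image fun p => p.1 :: p.2

theorem mem_heightLists {s : Finset ℤ} {k : ℕ} {l : List ℤ} :
    l ∈ heightLists s k ↔ l.length = k ∧ ∀ a ∈ l, a ∈ s := by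
  induction k generalizing l with
  | zero => simp +contextual [heightLists, List.length_eq_zero_iff]
  | succ k ih => cases l <;> simp [heightLists, ih, and_left_comm]

theorem sum_heightLists_succ (s : Finset ℤ) (k : ℕ) (f : List ℤ → ℝ) :
    ∑ l ∈ heightLists s (k + 1), f l = ∑ a ∈ s, ∑ l ∈ heightLists s k, f (a :: l) := by
  rw [heightLists, Finset.sum_image fun p _ q _ h => Prod.ext (List.cons.inj h).1
    (List.cons.inj h).2, Finset.sum_product]

theorem sum_pow_heightVariation_le {s : Finset ℤ} {r C : ℝ} (hr0 : 0 ≤ r) (hr1 : r ≤ 1)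
    (hC : ∀ y, ∑ a ∈ s, r ^ (y - a).natAbs ≤ C) (k : ℕ) (y y' : ℤ) :
    ∑ l ∈ heightLists s k, r ^ heightVariation y l y' ≤ C ^ k := by
  have hC0 : 0 ≤ C := (Finset.sum_nonneg fun _ _ => pow_nonneg hr0 _).trans (hC 0)
  induction k generalizing y with
  | zero => simpa only [heightLists, Finset.sum_singleton, heightVariation, pow_zero] using
      pow_le_one₀ hr0 hr1
  | succ k ih =>
    calc ∑ l ∈ heightLists s (k + 1), r ^ heightVariation y l y'
        = ∑ a ∈ s, r ^ (y - a).natAbs * ∑ l ∈ heightLists s k, r ^ heightVariation a l y' := by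
          simp only [sum_heightLists_succ, heightVariation, pow_add, Finset.mul_sum]
      _ ≤ ∑ a ∈ s, r ^ (y - a).natAbs * C ^ k :=
          Finset.sum_le_sum fun a _ => mul_le_mul_of_nonneg_left (ih a) (pow_nonneg hr0 _)
      _ = (∑ a ∈ s, r ^ (y - a).natAbs) * C ^ k := (Finset.sum_mul ..).symm
      _ ≤ C * C ^ k := mul_le_mul_of_nonneg_right (hC y) (pow_nonneg hC0 k)
      _ = C ^ (k + 1) := (pow_succ' C k).symm

theorem sum_pow_natAbs_le (s : Finset ℤ) {r : ℝ} (hr0 : 0 ≤ r) (hr1 : r < 1) (y : ℤ) :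
    ∑ a ∈ s, r ^ (y - a).natAbs ≤ (1 + r) / (1 - r) := by
  have hgeom : HasSum (fun k : ℕ => r ^ k) (1 - r)⁻¹ := hasSum_geometric_of_lt_one hr0 hr1
  have hsum : HasSum (fun z : ℤ => r ^ z.natAbs) ((1 - r)⁻¹ + r * (1 - r)⁻¹) := by
    refine HasSum.of_nat_of_neg_add_one (by simpa using hgeom) ?_
    have hneg : ∀ k : ℕ, (-((k : ℤ) + 1)).natAbs = k + 1 := fun k => by omega
    simpa only [hneg, pow_succ'] using hgeom.mul_left r
  calc ∑ a ∈ s, r ^ (y - a).natAbs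
      = ∑ z ∈ s.map (Equiv.subLeft y).toEmbedding, r ^ z.natAbs := by simp
    _ ≤ (1 - r)⁻¹ + r * (1 - r)⁻¹ := sum_le_hasSum _ (fun _ _ => pow_nonneg hr0 _) hsum
    _ = (1 + r) / (1 - r) := by rw [div_eq_mul_inv]; ring

theorem card_heightLists_heightVariation_le {s : Finset ℤ} {t C : ℝ} (b : ℝ) (ht : 0 ≤ t)
    (hC : ∀ y, ∑ a ∈ s, Real.exp (-t) ^ (y - a).natAbs ≤ C) (k : ℕ) (y y' : ℤ) :
    ((heightLists s k).filter fun l => (heightVariation y l y' : ℝ) ≤ b).card ≤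
      Real.exp (t * b) * C ^ k := by
  have hmarkov : ∀ l ∈ (heightLists s k).filter fun l => (heightVariation y l y' : ℝ) ≤ b,
      1 ≤ Real.exp (t * b) * Real.exp (-t) ^ heightVariation y l y' := fun l hl => by
    rw [← Real.exp_nat_mul, ← Real.exp_add, Real.one_le_exp_iff]
    linarith [mul_le_mul_of_nonneg_left (Finset.mem_filter.1 hl).2 ht]
  calc (((heightLists s k).filter fun l => (heightVariation y l y' : ℝ) ≤ b).card : ℝ)
      ≤ ∑ l ∈ (heightLists s k).filter fun l => (heightVariation y l y' : ℝ) ≤ b,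
          Real.exp (t * b) * Real.exp (-t) ^ heightVariation y l y' := by
        simpa only [nsmul_eq_mul, mul_one] using Finset.card_nsmul_le_sum _ _ _ hmarkov
    _ ≤ ∑ l ∈ heightLists s k, Real.exp (t * b) * Real.exp (-t) ^ heightVariation y l y' :=
        Finset.sum_le_sum_of_subset_of_nonneg (Finset.filter_subset _ _)
          fun _ _ _ => by positivity
    _ ≤ Real.exp (t * b) * C ^ k := by
        rw [← Finset.mul_sum]
        exact mul_le_mul_of_nonneg_left (sum_pow_heightVariation_le (Real.exp_pos _).le
          (Real.exp_le_one_iff.2 (neg_nonpos.2 ht)) hC k y y') (Real.exp_pos _).le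

end Heights

section Crossings

variable {n : ℕ} {H : SimpleGraph (GridVertex n)}

variable (H) in
/-- The graph `H` has horizontal edges at the heights `l` in the consecutive columns starting
at `x`: the `i`-th of them joins `(x + i, lᵢ)` to `(x + i + 1, lᵢ)`. -/
def HasCrossings : ℤ → List ℤ → Prop
  | _, [] => True
  | x, a :: l => (∃ p q, H.Adj p q ∧ p.1 = (x, a) ∧ q.1 = (x + 1, a)) ∧ HasCrossings (x + 1) l

theorem HasCrossings.getElem {x : ℤ} {l : List ℤ} (h : HasCrossings H x l) (i : ℕ)
    (hi : i < l.length) :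
    ∃ p q, H.Adj p q ∧ p.1 = (x + i, l[i]) ∧ q.1 = (x + i + 1, l[i]) := by
  induction l generalizing x i with
  | nil => simp at hi
  | cons a l ih =>
    cases i with
    | zero => simpa using h.1
    | succ i => simpa [add_assoc, add_comm (1 : ℤ)] using ih h.2 i (by simpa using hi)

theorem HasCrossings.mem_heightLists {x : ℤ} {l : List ℤ} (h : HasCrossings H x l) :
    l ∈ heightLists (Finset.Icc (1 : ℤ) n) l.length := by
  refine EdwardsAnderson.mem_heightLists.2 ⟨rfl, fun a ha => ?_⟩
  obtain ⟨i, hi, rfl⟩ := List.getElem_of_mem ha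
  obtain ⟨p, -, -, hp, -⟩ := h.getElem i hi
  simpa only [hp] using (Finset.mem_product.1 p.2).2

theorem natAbs_add_natAbs_le_length (hH : H ≤ grid n) {p q : GridVertex n} (w : H.Walk p q) :
    (p.1.1 - q.1.1).natAbs + (p.1.2 - q.1.2).natAbs ≤ w.length := by
  induction w with
  | nil => simp
  | cons h w ih =>
    have := grid_adj.1 (hH h)
    rw [SimpleGraph.Walk.length_cons]
    omega

/-- The list records, for each column between `p` and `q`, a height at which the walk crosses it,
so that the walk makes at least one horizontal step per column and its vertical steps join
successive heights. A step to the left adds a column at the front, which is then discarded. -/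
theorem exists_hasCrossings (hH : H ≤ grid n) {p q : GridVertex n} (w : H.Walk p q) (k : ℕ)
    (hk : q.1.1 = p.1.1 + k) :
    ∃ l : List ℤ, l.length = k ∧ HasCrossings H p.1.1 l ∧
      heightVariation p.1.2 l q.1.2 + k ≤ w.length := by
  induction w generalizing k with
  | nil => exact ⟨[], by simpa [eq_comm] using hk, trivial, by simp_all [heightVariation]⟩
  | @cons p r q h w ih =>
    have hadj := grid_adj.1 (hH h)
    rw [SimpleGraph.Walk.length_cons]
    have hstep : r.1.1 = p.1.1 ∨ (r.1.1 = p.1.1 + 1 ∧ r.1.2 = p.1.2) ∨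
        (r.1.1 + 1 = p.1.1 ∧ r.1.2 = p.1.2) := by omega
    rcases hstep with hx | ⟨hx, hy⟩ | ⟨hx, hy⟩
    · obtain ⟨l, hl, hcross, hlen⟩ := ih k (by omega)
      have := heightVariation_le_natAbs_add p.1.2 r.1.2 l q.1.2
      exact ⟨l, hl, hx ▸ hcross, by omega⟩
    · cases k with
      | zero =>
        have := natAbs_add_natAbs_le_length hH w
        exact ⟨[], rfl, trivial, by simp only [heightVariation]; omega⟩
      | succ k =>
        obtain ⟨l, hl, hcross, hlen⟩ := ih k (by push_cast at hk; omega)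
        refine ⟨p.1.2 :: l, by simp [hl], ⟨⟨p, r, h, rfl, Prod.ext hx hy⟩, hx ▸ hcross⟩, ?_⟩
        simp only [heightVariation, sub_self, Int.natAbs_zero, zero_add]
        rw [← hy]
        omega
    · obtain ⟨_ | ⟨a, l⟩, hl, hcross, hlen⟩ := ih (k + 1) (by push_cast; omega)
      · simp at hl
      · refine ⟨l, by simpa using hl, hx ▸ hcross.2, ?_⟩
        have := heightVariation_le_natAbs_add p.1.2 a l q.1.2
        simp only [heightVariation, hy] at hlen
        omega

end Crossings

/-! ### The union bound over crossings -/

section UnionBound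

variable {V : Type*} [Fintype V] {G : SimpleGraph V} [DecidableRel G.Adj]

theorem length_le_card_edgeSupport {k : G.edgeSet → ℕ} {u v : V} {w : (oddGraph G k).Walk u v}
    (hw : w.IsTrail) : w.length ≤ (edgeSupport G k).card := by
  classical
  rw [← SimpleGraph.Walk.length_edges, ← List.toFinset_card_of_nodup hw.edges_nodup,
    ← Finset.card_map (Function.Embedding.subtype _)]
  refine Finset.card_le_card fun e he => ?_
  induction e with
  | _ x y =>
    obtain ⟨hxy, hodd⟩ := (oddGraph_adj G).1 (w.adj_of_mem_edges (List.mem_toFinset.1 he))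
    exact Finset.mem_map.2
      ⟨⟨s(x, y), hxy⟩, Finset.mem_filter.2 ⟨Finset.mem_univ _, hodd.pos⟩, rfl⟩

theorem sum_spectralMass_le_sum_tsum [DecidableEq V] {ι : Type*} {u v : V}
    (s : Finset (Finset G.edgeSet)) (L : Finset ι) (K : ι → Set (G.edgeSet → ℕ))
    (hcover : ∀ k, edgeSupport G k ∈ s → fourierCoeff G u v k ≠ 0 → ∃ l ∈ L, k ∈ K l) :
    ∑ S ∈ s, spectralMass G u v S ≤
      ∑ l ∈ L, ∑' k : K l, ENNReal.ofReal (fourierCoeff G u v k.1 ^ 2) := by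
  classical
  set F : (G.edgeSet → ℕ) → ENNReal := fun k => ENNReal.ofReal (fourierCoeff G u v k ^ 2) with hF
  have hpointwise (k : G.edgeSet → ℕ) :
      ∑ S ∈ s, {k | edgeSupport G k = S}.indicator F k ≤ ∑ l ∈ L, (K l).indicator F k := by
    simp only [Set.indicator_apply, Set.mem_ofPred_eq, Finset.sum_ite_eq]
    split_ifs with hk
    · by_cases h0 : fourierCoeff G u v k = 0
      · simp [hF, h0]
      · obtain ⟨l, hl, hkl⟩ := hcover k hk h0
        exact (if_pos hkl).ge.trans
          (Finset.single_le_sum (f := fun l => if k ∈ K l then F k else 0) (fun _ _ => zero_le) hl)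
    · exact zero_le
  calc ∑ S ∈ s, spectralMass G u v S
      = ∑ S ∈ s, ∑' k, {k | edgeSupport G k = S}.indicator F k :=
        Finset.sum_congr rfl fun S _ => tsum_subtype {k | edgeSupport G k = S} F
    _ = ∑' k, ∑ S ∈ s, {k | edgeSupport G k = S}.indicator F k :=
        (Summable.tsum_finsetSum fun _ _ => ENNReal.summable).symm
    _ ≤ ∑' k, ∑ l ∈ L, (K l).indicator F k := ENNReal.tsum_le_tsum hpointwise
    _ = ∑ l ∈ L, ∑' k, (K l).indicator F k :=
        Summable.tsum_finsetSum fun _ _ => ENNReal.summable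
    _ = ∑ l ∈ L, ∑' k : K l, F k := Finset.sum_congr rfl fun l _ => (tsum_subtype (K l) F).symm

end UnionBound

section Grid

variable {n : ℕ} {u v : GridVertex n}

theorem tsum_sq_fourierCoeff_le_of_hasCrossings {x : ℤ} {m : ℕ} {l : List ℤ} (hx : 1 ≤ x)
    (hxn : x + m ≤ n) (hl : l ∈ heightLists (Finset.Icc (1 : ℤ) n) m) :
    ∑' k : {k | HasCrossings (oddGraph (grid n) k) x l},
        ENNReal.ofReal (fourierCoeff (grid n) u v k.1 ^ 2) ≤
      (1 - shieldProb 16 ^ 16) ^ ((m + 2) / 3) := by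
  obtain ⟨hlen, hmem⟩ := mem_heightLists.1 hl
  have hidx (j : Fin ((m + 2) / 3)) : 3 * (j : ℕ) < l.length := by omega
  let p (j : Fin ((m + 2) / 3)) : GridVertex n := ⟨(x + (3 * j : ℕ), l[3 * (j : ℕ)]'(hidx j)),
    Finset.mem_product.2 ⟨Finset.mem_Icc.2 (by have := hidx j; dsimp only; omega),
      hmem _ (List.getElem_mem _)⟩⟩
  have hp (j) : (p j).1.1 < n := by have := hidx j; dsimp only [p]; omega
  have hdisj : Pairwise (Function.onFun Disjoint fun j => (gridSquare (p j) (hp j)).block) :=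
    fun i j hij => disjoint_block_gridSquare _ _ <| by
      have := Fin.val_ne_of_ne hij
      dsimp only [p]
      omega
  have hbound := tsum_sq_fourierCoeff_le_of_odd (grid_preconnected u v)
    (fun j => gridSquare (p j) (hp j)) (fun j => FourCycle.card_block_le _ degree_grid_le) hdisj
  rw [Fintype.card_fin] at hbound
  refine (ENNReal.tsum_mono_subtype
    (fun k => ENNReal.ofReal (fourierCoeff (grid n) u v k ^ 2)) ?_).trans hbound
  intro k hk j
  obtain ⟨a, b, hab, ha, hb⟩ := HasCrossings.getElem hk _ (hidx j)
  obtain ⟨_, hodd⟩ := (oddGraph_adj (grid n)).1 hab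
  obtain rfl : a = (gridSquare (p j) (hp j)).a := Subtype.ext ha
  obtain rfl : b = (gridSquare (p j) (hp j)).b := Subtype.ext hb
  exact hodd

theorem exists_hasCrossings_of_fourierCoeff_ne_zero {m : ℕ} {k : (grid n).edgeSet → ℕ}
    (hcol : v.1.1 = u.1.1 + m) (hk : fourierCoeff (grid n) u v k ≠ 0) :
    ∃ l ∈ heightLists (Finset.Icc (1 : ℤ) n) m, HasCrossings (oddGraph (grid n) k) u.1.1 l ∧
      heightVariation u.1.2 l v.1.2 + m ≤ (edgeSupport (grid n) k).card := by
  obtain ⟨w, hw⟩ := (reachable_oddGraph_of_fourierCoeff_ne_zero (grid n)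
    (grid_preconnected u v) hk).exists_isPath
  have hle : oddGraph (grid n) k ≤ grid n := fun x y h => ((oddGraph_adj (grid n)).1 h).1
  obtain ⟨l, rfl, hcross, hvar⟩ := exists_hasCrossings hle w m hcol
  exact ⟨l, hcross.mem_heightLists, hcross,
    hvar.trans (length_le_card_edgeSupport hw.isTrail)⟩

/-- Since `c` is even, either `c = 0` or the loss of one in the hypothesis is at most `c / 2`. -/
theorem le_two_mul_of_even {c m N : ℕ} {ε : ℝ} (hε : 0 ≤ ε) (hc : Even c) (hN : c + m ≤ N)
    (hNm : (N : ℝ) ≤ (1 + ε) * (m + 1 : ℕ)) : (c : ℝ) ≤ 2 * ε * (m + 1 : ℕ) := by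
  obtain ⟨_ | d, rfl⟩ := hc
  · simpa using mul_nonneg (mul_nonneg two_pos.le hε) (by positivity : (0 : ℝ) ≤ m + 1)
  · have hcast : (d + 1 + (d + 1) + m : ℝ) ≤ N := by exact_mod_cast hN
    push_cast at hNm ⊢
    linarith [d.cast_nonneg (α := ℝ)]

theorem sum_spectralMass_le_card_heightLists {m : ℕ} {ε : ℝ} (hε : 0 ≤ ε)
    (huv : v.1 = (u.1.1 + m, u.1.2)) :
    ∑ S : Finset (grid n).edgeSet with (S.card : ℝ) ≤ (1 + ε) * (m + 1 : ℕ),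
        spectralMass (grid n) u v S ≤
      ((heightLists (Finset.Icc (1 : ℤ) n) m).filter fun l =>
          (heightVariation u.1.2 l u.1.2 : ℝ) ≤ 2 * ε * (m + 1 : ℕ)).card *
        (1 - shieldProb 16 ^ 16) ^ ((m + 2) / 3) := by
  obtain ⟨hcol, hrow⟩ := Prod.ext_iff.1 huv
  refine (sum_spectralMass_le_sum_tsum _
    ((heightLists (Finset.Icc (1 : ℤ) n) m).filter fun l =>
      (heightVariation u.1.2 l u.1.2 : ℝ) ≤ 2 * ε * (m + 1 : ℕ))
    (fun l => {k | HasCrossings (oddGraph (grid n) k) u.1.1 l}) fun k hk hk0 => ?_).trans ?_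
  · obtain ⟨l, hl, hcross, hvar⟩ := exists_hasCrossings_of_fourierCoeff_ne_zero hcol hk0
    rw [hrow] at hvar
    have heven : Even (heightVariation u.1.2 l u.1.2) := by simp [even_heightVariation_iff]
    exact ⟨l, Finset.mem_filter.2
      ⟨hl, le_two_mul_of_even hε heven hvar (Finset.mem_filter.1 hk).2⟩, hcross⟩
  · rw [← nsmul_eq_mul]
    have hvn : u.1.1 + m ≤ n := hcol.ge.trans (gridVertex_bounds v).2.1
    exact Finset.sum_le_card_nsmul _ _ _ fun l hl => tsum_sq_fourierCoeff_le_of_hasCrossings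
      (gridVertex_bounds u).1 hvn (Finset.mem_filter.1 hl).1

end Grid

section Rates

theorem exists_one_sub_shieldProb_pow_le (N : ℕ) :
    ∃ κ : ℝ, 0 < κ ∧ 1 - shieldProb N ^ N ≤ ENNReal.ofReal (Real.exp (-κ)) := by
  have hlt : 1 - shieldProb N ^ N < 1 :=
    ENNReal.sub_lt_self ENNReal.one_ne_top one_ne_zero (pow_ne_zero N (shieldProb_pos N).ne')
  obtain ⟨r, hr, hr1⟩ := ENNReal.lt_iff_exists_nnreal_btwn.1 hlt
  have hr0 : 0 < (r : ℝ) := NNReal.coe_pos.2 (ENNReal.coe_pos.1 (zero_le.trans_lt hr))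
  refine ⟨-Real.log r, neg_pos.2 (Real.log_neg hr0 (by exact_mod_cast hr1)), ?_⟩
  rw [neg_neg, Real.exp_log hr0, ENNReal.ofReal_coe_nnreal]
  exact hr.le

theorem exists_one_add_exp_div_one_sub_exp_le {δ : ℝ} (hδ : 0 < δ) :
    ∃ t : ℝ, 0 < t ∧ (1 + Real.exp (-t)) / (1 - Real.exp (-t)) ≤ Real.exp δ := by
  have hexp : Filter.Tendsto (fun t : ℝ => Real.exp (-t)) Filter.atTop (nhds 0) :=
    Real.tendsto_exp_neg_atTop_nhds_zero
  have hlim : Filter.Tendsto (fun t : ℝ => (1 + Real.exp (-t)) / (1 - Real.exp (-t)))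
      Filter.atTop (nhds 1) := by
    simpa only [add_zero, sub_zero, div_one] using!
      (hexp.const_add 1).div (hexp.const_sub 1) (by norm_num)
  exact ((Filter.eventually_gt_atTop 0).and
    (hlim.eventually_le_const (Real.one_lt_exp_iff.2 hδ))).exists

theorem exp_mul_exp_pow_mul_exp_pow_le {κ t : ℝ} (hκ : 0 < κ) (ht : 0 < t) {m : ℕ} (hm : 1 ≤ m) :
    Real.exp (t * (2 * (κ / (48 * t)) * (m + 1 : ℕ))) * Real.exp (κ / 6) ^ m *
        Real.exp (-κ) ^ ((m + 2) / 3) ≤ Real.exp (-(κ / 24 * (m + 1 : ℕ))) := by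
  have hfloor : (m : ℝ) ≤ 3 * ((m + 2) / 3 : ℕ) := by exact_mod_cast (by omega)
  have hm1 : (1 : ℝ) ≤ m := by exact_mod_cast hm
  have hcancel : t * (2 * (κ / (48 * t)) * (m + 1 : ℕ)) = κ / 24 * (m + 1 : ℕ) := by
    field_simp
    ring
  rw [hcancel, ← Real.exp_nat_mul, ← Real.exp_nat_mul, ← Real.exp_add, ← Real.exp_add,
    Real.exp_le_exp]
  push_cast
  linarith [mul_le_mul_of_nonneg_left hfloor hκ.le, mul_le_mul_of_nonneg_left hm1 hκ.le]

end Rates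

end EdwardsAnderson

open EdwardsAnderson in
theorem theorem2p3_general :
    ∃ ε : ℝ, 0 < ε ∧ ∃ c : ℝ, 0 < c ∧ ∀ (n m : ℕ) (u v : GridVertex n), 1 ≤ m →
      v.1 = (u.1.1 + m, u.1.2) →
      ∑ S : Finset (grid n).edgeSet with (S.card : ℝ) ≤ (1 + ε) * (m + 1 : ℕ),
          spectralMass (grid n) u v S
        ≤ ENNReal.ofReal (Real.exp (-(c * (m + 1 : ℕ)))) := by
  obtain ⟨κ, hκ, hrate⟩ := exists_one_sub_shieldProb_pow_le 16
  obtain ⟨t, ht, hentropy⟩ := exists_one_add_exp_div_one_sub_exp_le (δ := κ / 6) (by positivity)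
  refine ⟨κ / (48 * t), by positivity, κ / 24, by positivity, fun n m u v hm huv => ?_⟩
  have hr1 : Real.exp (-t) < 1 := Real.exp_lt_one_iff.2 (neg_neg_of_pos ht)
  have hcount := card_heightLists_heightVariation_le (s := Finset.Icc (1 : ℤ) n)
    (2 * (κ / (48 * t)) * (m + 1 : ℕ)) ht.le
    (fun y => (sum_pow_natAbs_le _ (Real.exp_pos _).le hr1 y).trans hentropy) m u.1.2 u.1.2
  refine (sum_spectralMass_le_card_heightLists (by positivity) huv).trans ?_
  grw [hrate]
  rw [← ENNReal.ofReal_pow (Real.exp_pos _).le, ← ENNReal.ofReal_natCast,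
    ← ENNReal.ofReal_mul (Nat.cast_nonneg _)]
  grw [hcount]
  exact ENNReal.ofReal_le_ofReal (exp_mul_exp_pow_mul_exp_pow_le hκ ht hm)

theorem theorem2p3 :
    ∃ ε : ℝ, 0 < ε ∧ ∃ c : ℝ, 0 < c ∧ ∀ (n : ℕ) (hn : 2 ≤ n), Even n →
      ∑ S : Finset (EdwardsAnderson.grid n).edgeSet with (S.card : ℝ) ≤ (1 + ε) * n,
          EdwardsAnderson.spectralMass (EdwardsAnderson.grid n)
            (EdwardsAnderson.leftVertex n hn) (EdwardsAnderson.rightVertex n hn) S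
        ≤ ENNReal.ofReal (Real.exp (-(c * n))) := by
  obtain ⟨ε, hε, c, hc, h⟩ := theorem2p3_general
  refine ⟨ε, hε, c, hc, fun n hn _ => ?_⟩
  obtain ⟨m, rfl⟩ := Nat.exists_eq_add_of_le' (one_le_two.trans hn)
  exact h (m + 1) m _ _ (by omega)
    (Prod.ext (by simp [EdwardsAnderson.leftVertex, EdwardsAnderson.rightVertex, add_comm]) rfl)
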